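/- Let $\alpha>0$, $\lambda<0$, $\omega>0$ and $\nu,\kappa,h\in\mathbb{R}$, and let $R\in\mathbb{C}$ satisfy \[ R=-\frac{h}{2\omega}\,\frac{1}{\frac{3\lambda}{2\omega}|R|^2-(\kappa^2+\nu)+\frac{\mathrm{i}\alpha}{2}}. \] Put $\eta(\xi)=R\,e^{-\mathrm{i}\kappa\xi}$, so that $e^{\mathrm{i}\nu\tau}\eta(\xi)$ is a particular solution of the Lugiato--Lefever equation $\mathrm{i}A_\tau=-A_{\xi\xi}-\frac{\mathrm{i}\alpha}{2}A-\frac{3\lambda}{2\omega}|A|^2A-\frac{h}{2\omega}e^{-\mathrm{i}(\kappa\xi-\nu\tau)}$ on $\mathbb{R}$, and write $A=e^{\mathrm{i}\nu\tau}(\phi+\eta)$. Then $\phi$ has to solve \[ \mathrm{i}\phi_\tau=-\phi_{\xi\xi}-\frac{\mathrm{i}\alpha}{2}\phi-\Big(\frac{3\lambda}{2\omega}|R|^2-\nu\Big)\phi+N(\phi),\qquad N(\phi)=-\frac{3\lambda}{2\omega}\big[|\phi+\eta|^2-|\eta|^2\big](\phi+\eta). \tag{1} \] For an integer $k\ge 1$,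 $\varphi\in H^k(\mathbb{R})$ and $T\in(0,\infty]$, a mild solution of (1) on $[0,T)$ with initial value $\varphi$ is a function $\phi\in C([0,T),H^k(\mathbb{R}))$ such that for all $\tau\in[0,T)$ \[ \phi(\tau)=U(\tau)\varphi+\mathrm{i}\int_0^\tau U(\tau-\tau')\Big[\frac{\mathrm{i}\alpha}{2}\phi(\tau')+\Big(\frac{3\lambda}{2\omega}|R|^2-\nu\Big)\phi(\tau')-N(\phi(\tau'))\Big]\,d\tau', \qquad U(\tau)=e^{\mathrm{i}\tau\partial_\xi^2}. \] Here $H^k(\mathbb{R})$ carries the norm $\|\phi\|_{H^k}=\big(\sum_{i=0}^k\|D^i_\xi\phi\|_{L^2}^2\big)^{1/2}$. Theorem. For every integer $k\ge1$ and every $\varphi\in H^k(\mathbb{R})$ there are $\tau_m\in(0,\infty]$ and a mild solution $\phi\in C([0,\tau_m),H^k(\mathbb{R}))$ of (1) on $[0,\tau_m)$ with initial value $\varphi$ that is the unique maximal one: whenever $\psi\in C([0,T),H^k(\mathbb{R}))$ is a mild solution of (1) on $[0,T)$ with initial value $\varphi$, then $T\le\tau_m$ and $\psi=\phi$ on $[0,T)$.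 Moreover, either 1. $\tau_m=\infty$ (the solution is global), or 2. $\tau_m<\infty$, and then $\|\phi(\tau)\|_{H^k(\mathbb{R})}\to\infty$ as $\tau\uparrow\tau_m$ and $\limsup_{\tau\uparrow\tau_m}\|\phi(\tau)\|_{L^\infty(\mathbb{R})}=\infty$. -/

import Mathlib

open MeasureTheory Filter Topology Set
open scoped ENNReal SchwartzMap LineDeriv FourierTransform

noncomputable section

namespace LugiatoLefever

/-- Complex-valued `L²(ℝ)`. -/
abbrev L2 : Type := Lp ℂ 2 (volume : Measure ℝ)

/-- `g` is the weak (distributional) derivative of `f`. -/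
def IsWeakDeriv (f g : L2) : Prop :=
  ∂_{(1 : ℝ)} (f : 𝓢'(ℝ, ℂ)) = (g : 𝓢'(ℝ, ℂ))

/-- The Sobolev space `H^k(ℝ)`. A function `f` in `H^k(ℝ)` is recorded together with its weak
derivatives as the tuple `(f, Df, …, D^k f)` in `(L²)^{k+1}`; the tuple is determined by its entry
`0`, which is `f`. The norm inherited from the `ℓ²` product is `(∑_{i ≤ k} ‖D^i f‖²_{L²})^{1/2}`. -/
def Hk (k : ℕ) : Submodule ℂ (PiLp 2 (fun _ : Fin (k + 1) => L2)) where
  carrier := {u | ∀ i : Fin k, IsWeakDeriv (u i.castSucc) (u i.succ)}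
  zero_mem' := by
    intro i
    simp only [IsWeakDeriv, PiLp.zero_apply, ← Lp.toTemperedDistributionCLM_apply]
    rw [map_zero]
    exact (LineDeriv.lineDerivOpCLM ℂ 𝓢'(ℝ, ℂ) (1 : ℝ)).map_zero
  add_mem' := by
    intro u v hu hv i
    have h1 := hu i
    have h2 := hv i
    simp only [IsWeakDeriv, PiLp.add_apply, ← Lp.toTemperedDistributionCLM_apply] at h1 h2 ⊢
    rw [map_add, map_add, LineDeriv.lineDerivOp_add, h1, h2]
  smul_mem' := by
    intro c u hu i
    have h1 := hu i
    simp only [IsWeakDeriv, PiLp.smul_apply, ← Lp.toTemperedDistributionCLM_apply] at h1 ⊢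
    rw [map_smul, map_smul, LineDeriv.lineDerivOp_smul, h1]

/-- The underlying `L²` function of an element of `H^k(ℝ)`. -/
def toL2 {k : ℕ} (u : Hk k) : L2 := (u : PiLp 2 (fun _ : Fin (k + 1) => L2)) 0

/-- The Fourier symbol of `exp (i t ∂²)`; Mathlib's Fourier transform uses `exp (-2π i x ξ)`, so
`∂²` has symbol `-4π² x²`. -/
def schrodingerSymbol (t : ℝ) (x : ℝ) : ℂ :=
  Complex.exp (((-(4 * Real.pi ^ 2 * x ^ 2 * t) : ℝ) : ℂ) * Complex.I)

theorem schrodingerSymbol_memLp (t : ℝ) : MemLp (schrodingerSymbol t) ∞ (volume : Measure ℝ) := by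
  refine memLp_top_of_bound ?_ 1 (Eventually.of_forall fun x => ?_)
  · exact Continuous.aestronglyMeasurable (by unfold schrodingerSymbol; fun_prop)
  · rw [schrodingerSymbol, Complex.norm_exp_ofReal_mul_I]

/-- The free Schrödinger evolution operator `U(t) = exp (i t ∂²)` on `L²(ℝ)`. -/
def freeEvolution (t : ℝ) (f : L2) : L2 :=
  𝓕⁻ (((schrodingerSymbol_memLp t).toLp (schrodingerSymbol t) • (𝓕 f : L2) : L2))

/-- The spatial profile `η(ξ) = R exp (-i κ ξ)` of the background. -/
def background (R : ℂ) (κ : ℝ) (ξ : ℝ) : ℂ :=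
  R * Complex.exp (-(Complex.I * (κ : ℂ) * (ξ : ℂ)))

/-- The nonlinearity `N(f) = -(3λ/2ω) [|f + η|² - |η|²] (f + η)`. -/
def nonlinearity (lam ω κ : ℝ) (R : ℂ) (f : ℝ → ℂ) (ξ : ℝ) : ℂ :=
  -((3 * lam / (2 * ω) : ℝ) : ℂ) *
    ((‖f ξ + background R κ ξ‖ ^ 2 - ‖background R κ ξ‖ ^ 2 : ℝ) : ℂ) *
      (f ξ + background R κ ξ)

/-- The integrand `(iα/2) f + (3λ|R|²/2ω - ν) f - N(f)` of Duhamel's formula (before `U` acts). -/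
def forcing (α lam ω ν κ : ℝ) (R : ℂ) (f : ℝ → ℂ) (ξ : ℝ) : ℂ :=
  Complex.I * ((α / 2 : ℝ) : ℂ) * f ξ
    + ((3 * lam / (2 * ω) * ‖R‖ ^ 2 - ν : ℝ) : ℂ) * f ξ
    - nonlinearity lam ω κ R f ξ

/-- The time interval `[0, T)`, where `T` may be `+∞`. -/
def timeInterval (T : EReal) : Set ℝ := {t : ℝ | 0 ≤ t ∧ (t : EReal) < T}

/-- `φ ∈ C([0, T), H^k)` is a mild solution, with initial value `φ₀`, of
`i φ_τ = -φ_ξξ - (iα/2) φ - (3λ|R|²/2ω - ν) φ + N(φ)`: Duhamel's formula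
`φ(t) = U(t) φ₀ + i ∫₀ᵗ U(t - s) G(s) ds` holds, where `G(s) ∈ L²` is the class of the function
`(iα/2) φ(s) + (3λ|R|²/2ω - ν) φ(s) - N(φ(s))`. Only the values of `φ` on `[0, T)` matter. -/
structure IsMildSolution (α lam ω ν κ : ℝ) (R : ℂ) {k : ℕ} (φ₀ : Hk k) (T : EReal)
    (φ : ℝ → Hk k) : Prop where
  continuousOn : ContinuousOn φ (timeInterval T)
  initial : 0 ∈ timeInterval T → φ 0 = φ₀
  duhamel : ∃ G : ℝ → L2,
    (∀ s ∈ timeInterval T, G s =ᵐ[volume] forcing α lam ω ν κ R (toL2 (φ s))) ∧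
    ∀ t ∈ timeInterval T,
      IntervalIntegrable (fun s => freeEvolution (t - s) (G s)) volume 0 t ∧
      toL2 (φ t) = freeEvolution t (toL2 φ₀)
        + Complex.I • ∫ s in (0 : ℝ)..t, freeEvolution (t - s) (G s)

end LugiatoLefever

end

/-!
The equation is solved in the interaction picture. The free group `U(t) = exp (it∂²)` acts on
`H^k` by isometries, so `v(t) = U(-t) φ(t)` turns Duhamel's formula into the integrated form of an
ordinary differential equation `v' = i U(-t) F(U(t) v)` in the Banach space `H^k`, without loss of
derivatives. For `k ≥ 1` the space `H^k` is an algebra (`Hk.exists_mul`) on which conjugation and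
multiplication by `η` act boundedly, and `|φ + η|² - |η|² = φ φ̄ + η̄ φ + η φ̄`, so the forcing `F` is
Lipschitz on every ball of `H^k` and vanishes at `0`. The Picard–Lindelöf and Grönwall theorems then
give the unique maximal solution; since the local existence time depends only on the norm of the
initial value, the norm tends to infinity at a finite maximal time
(`IsUniformlyLipschitzField.exists_maximal`).

For the sup norm, the point is that the product estimates are tame. In `H¹` one has
`‖u v‖ ≲ ‖u‖_∞ ‖v‖ + ‖v‖_∞ ‖u‖`; in `H^(k+2)` the same holds with the `H^(k+1)` norm in place of the
sup norm, because `D(u v) = Du · v + u · Dv` is estimated with the algebra property of `H^(k+1)`.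
So `F` grows linearly in the norm of each level as long as the level below is bounded, and
Grönwall's inequality carries a bound on `‖φ‖_∞` up to `H^k` (`Hk.bounded_of_sup_bounded`).
A blow-up of the `H^k` norm therefore forces one of the sup norm.

The weak derivative is handled in two ways: on the Fourier side it is multiplication by `2πix`
(`isWeakDeriv_iff_fourier`), which makes it commute with `U(t)`; and Schwartz functions are dense in
its graph (`IsWeakDeriv.exists_schwartz_tendsto`), which reduces the Sobolev bound, the product rule,
conjugation and multiplication by `η` to classical derivatives.
-/

noncomputable section

namespace LugiatoLefever

/-! ### Weak derivatives in `L²` -/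

/-- Weak derivatives are characterised by integration against Schwartz functions. -/
theorem isWeakDeriv_iff_integral {f g : L2} :
    IsWeakDeriv f g ↔ ∀ φ : 𝓢(ℝ, ℂ), ∫ x, deriv φ x * f x = -∫ x, φ x * g x := by
  unfold IsWeakDeriv
  rw [DFunLike.ext_iff]
  refine forall_congr' fun φ => ?_
  rw [TemperedDistribution.lineDerivOp_apply_apply, map_neg, Lp.toTemperedDistribution_apply,
    Lp.toTemperedDistribution_apply, neg_eq_iff_eq_neg]
  simp [SchwartzMap.lineDerivOp_apply_eq_fderiv]

theorem L2.locallyIntegrable (f : L2) : LocallyIntegrable f volume :=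
  (Lp.memLp f).locallyIntegrable (by norm_num)

/-- On the Fourier side the weak derivative is multiplication by `2πix`. -/
theorem isWeakDeriv_iff_fourier {f g : L2} :
    IsWeakDeriv f g ↔
      (𝓕 g : L2) =ᵐ[volume] fun x : ℝ => (2 * Real.pi * Complex.I * x : ℂ) * (𝓕 f : L2) x := by
  have key : IsWeakDeriv f g ↔ ∀ φ : 𝓢(ℝ, ℂ),
      ∫ x, (2 * Real.pi * Complex.I) * ((x * φ x) * (𝓕 f : L2) x) = ∫ x, φ x * (𝓕 g : L2) x := by
    have h1 : IsWeakDeriv f g ↔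
        𝓕 (∂_{(1 : ℝ)} (f : 𝓢'(ℝ, ℂ))) = 𝓕 (g : 𝓢'(ℝ, ℂ)) := by
      constructor
      · intro h; rw [h]
      · intro h
        have := congrArg (fun T => 𝓕⁻ T) h
        simpa [IsWeakDeriv] using this
    rw [h1, TemperedDistribution.fourier_lineDerivOp_eq, Lp.fourier_toTemperedDistribution_eq,
      Lp.fourier_toTemperedDistribution_eq, DFunLike.ext_iff]
    refine forall_congr' fun φ => ?_
    have hT2 : Function.HasTemperateGrowth (fun x : ℝ => (x : ℂ)) := by fun_prop
    simp [SchwartzMap.smulLeftCLM_apply_apply hT2, integral_const_mul]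
  have eint : ∀ φ : ℝ → ℂ, ∫ x : ℝ, (2 * Real.pi * Complex.I) * ((x * φ x) * (𝓕 f : L2) x)
      = ∫ x : ℝ, φ x * ((2 * Real.pi * Complex.I * x : ℂ) * (𝓕 f : L2) x) := fun φ => by
    congr 1; ext x; ring
  rw [key]
  constructor
  · intro h
    refine ae_eq_of_integral_contDiff_smul_eq (L2.locallyIntegrable _) ?_ ?_
    · exact (L2.locallyIntegrable (𝓕 f)).continuous_mul (by fun_prop)
    · intro φ hφ hφc
      have h₁ : HasCompactSupport (Complex.ofRealCLM ∘ φ) := hφc.comp_left rfl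
      have h₂ : ContDiff ℝ ((⊤ : ℕ∞) : WithTop ℕ∞) (Complex.ofRealCLM ∘ φ) := by fun_prop
      have h3 := h (h₁.toSchwartzMap h₂)
      rw [eint] at h3
      simpa using h3.symm
  · intro h φ
    rw [eint]
    refine integral_congr_ae ?_
    filter_upwards [h] with x hx
    rw [hx]

theorem IsWeakDeriv.unique {f g g' : L2} (h : IsWeakDeriv f g) (h' : IsWeakDeriv f g') : g = g' := by
  have h2 : Lp.toTemperedDistributionCLM ℂ volume 2 g = Lp.toTemperedDistributionCLM ℂ volume 2 g' :=
    (h.symm.trans h')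
  have := Lp.ker_toTemperedDistributionCLM_eq_bot (E := ℝ) (F := ℂ) (μ := volume) (p := 2)
  exact LinearMap.ker_eq_bot.1 this h2

theorem isClosed_isWeakDeriv : IsClosed {p : L2 × L2 | IsWeakDeriv p.1 p.2} := by
  have h1 : Continuous fun p : L2 × L2 =>
      LineDeriv.lineDerivOpCLM ℂ 𝓢'(ℝ, ℂ) (1 : ℝ) (Lp.toTemperedDistributionCLM ℂ volume 2 p.1) := by
    fun_prop
  have h2 : Continuous fun p : L2 × L2 => Lp.toTemperedDistributionCLM ℂ volume 2 p.2 := by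
    fun_prop
  exact isClosed_eq h1 h2

/-- A classical derivative is a weak derivative. -/
theorem IsWeakDeriv.of_hasDerivAt {f g : L2} {F G : ℝ → ℂ} (hF : ∀ x, HasDerivAt F (G x) x)
    (hf : f =ᵐ[volume] F) (hg : g =ᵐ[volume] G) : IsWeakDeriv f g := by
  rw [isWeakDeriv_iff_integral]
  intro φ
  have hφ : MemLp φ 2 volume := φ.memLp 2 volume
  have hφ' : MemLp (fun x => deriv φ x) 2 volume := (SchwartzMap.derivCLM ℂ ℂ φ).memLp 2 volume
  have hF2 : MemLp F 2 volume := (memLp_congr_ae hf).1 (Lp.memLp f)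
  have hG2 : MemLp G 2 volume := (memLp_congr_ae hg).1 (Lp.memLp g)
  have e1 : ∫ x, deriv φ x * f x = ∫ x, F x * deriv φ x := by
    refine integral_congr_ae ?_
    filter_upwards [hf] with x hx
    rw [hx, mul_comm]
  have e2 : ∫ x, φ x * g x = ∫ x, G x * φ x := by
    refine integral_congr_ae ?_
    filter_upwards [hg] with x hx
    rw [hx, mul_comm]
  rw [e1, e2]
  exact integral_mul_deriv_eq_deriv_mul_of_integrable (fun x _ => hF x)
    (fun x _ => φ.differentiableAt.hasDerivAt) (hF2.integrable_mul hφ') (hG2.integrable_mul hφ)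
    (hF2.integrable_mul hφ)

/-- Complex conjugation of a Schwartz function. -/
def schwartzConj (φ : 𝓢(ℝ, ℂ)) : 𝓢(ℝ, ℂ) :=
  SchwartzMap.postcompCLM (𝕜 := ℝ) (Complex.conjCLE : ℂ →L[ℝ] ℂ) φ

@[simp]
theorem schwartzConj_apply (φ : 𝓢(ℝ, ℂ)) (x : ℝ) :
    schwartzConj φ x = (starRingEnd ℂ) (φ x) := rfl

theorem deriv_schwartzConj (φ : 𝓢(ℝ, ℂ)) (x : ℝ) :
    deriv (schwartzConj φ) x = (starRingEnd ℂ) (deriv φ x) := by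
  have h : HasDerivAt φ (deriv φ x) x := φ.differentiableAt.hasDerivAt
  exact ((Complex.conjCLE : ℂ →L[ℝ] ℂ).hasFDerivAt.comp_hasDerivAt x h).deriv

/-- The derivative of a Schwartz function, as an element of `L²`. -/
theorem IsWeakDeriv.schwartz (φ : 𝓢(ℝ, ℂ)) :
    IsWeakDeriv (φ.toLp 2) ((SchwartzMap.derivCLM ℂ ℂ φ).toLp 2) :=
  .of_hasDerivAt (fun x => φ.hasDerivAt x) (φ.coeFn_toLp 2 volume)
    ((SchwartzMap.derivCLM ℂ ℂ φ).coeFn_toLp 2 volume)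

/-- The only `L²` solution of `f'' = f` is zero. -/
theorem IsWeakDeriv.eq_zero_of_symm {f g : L2} (h : IsWeakDeriv f g) (h' : IsWeakDeriv g f) :
    f = 0 := by
  rw [isWeakDeriv_iff_fourier] at h h'
  have h0 : (𝓕 f : L2) = 0 := by
    rw [Lp.eq_zero_iff_ae_eq_zero]
    filter_upwards [h, h'] with x hx hx'
    rw [hx] at hx'
    have e : ((1 + (2 * Real.pi * x) ^ 2 : ℝ) : ℂ) * (𝓕 f : L2) x = 0 := by
      push_cast
      linear_combination hx' + (2 * Real.pi * x) ^ 2 * (𝓕 f : L2) x * Complex.I_sq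
    have hne : ((1 + (2 * Real.pi * x) ^ 2 : ℝ) : ℂ) ≠ 0 := by
      exact_mod_cast (by positivity)
    exact (mul_eq_zero.1 e).resolve_left hne
  rw [← norm_eq_zero, ← Lp.norm_fourier_eq, h0, norm_zero]

theorem isWeakDeriv_add {f g f' g' : L2} (h : IsWeakDeriv f f') (h' : IsWeakDeriv g g') :
    IsWeakDeriv (f + g) (f' + g') := by
  simp only [IsWeakDeriv, ← Lp.toTemperedDistributionCLM_apply] at h h' ⊢
  rw [map_add, map_add, LineDeriv.lineDerivOp_add, h, h']

theorem isWeakDeriv_smul {f f' : L2} (c : ℂ) (h : IsWeakDeriv f f') :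
    IsWeakDeriv (c • f) (c • f') := by
  simp only [IsWeakDeriv, ← Lp.toTemperedDistributionCLM_apply] at h ⊢
  rw [map_smul, map_smul, LineDeriv.lineDerivOp_smul, h]

/-- The graph of the derivative on Schwartz functions, as a subspace of `L² × L²`. -/
def schwartzGraph : Submodule ℂ (WithLp 2 (L2 × L2)) :=
  LinearMap.range ((WithLp.linearEquiv 2 ℂ (L2 × L2)).symm.toLinearMap ∘ₗ
    ((SchwartzMap.toLpCLM ℂ ℂ 2 volume).toLinearMap.prod
      (SchwartzMap.toLpCLM ℂ ℂ 2 volume ∘L SchwartzMap.derivCLM ℂ ℂ).toLinearMap))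

theorem mem_schwartzGraph {p : WithLp 2 (L2 × L2)} : p ∈ schwartzGraph ↔
    ∃ φ : 𝓢(ℝ, ℂ), WithLp.toLp 2 (φ.toLp 2, (SchwartzMap.derivCLM ℂ ℂ φ).toLp 2) = p := Iff.rfl

/-- A pair `(u, v)` orthogonal to the Schwartz graph satisfies `v' = u` weakly. -/
theorem isWeakDeriv_swap_of_mem_orthogonal {p : WithLp 2 (L2 × L2)} (hp : p ∈ schwartzGraphᗮ) :
    IsWeakDeriv p.snd p.fst := by
  rw [isWeakDeriv_iff_integral]
  intro φ
  have h := (Submodule.mem_orthogonal _ _).1 hp _ (mem_schwartzGraph.2 ⟨schwartzConj φ, rfl⟩)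
  rw [WithLp.prod_inner_apply, L2.inner_def, L2.inner_def] at h
  have e1 : ∫ x, inner ℂ ((schwartzConj φ).toLp 2 volume x) (p.fst x) = ∫ x, φ x * p.fst x := by
    refine integral_congr_ae ?_
    filter_upwards [(schwartzConj φ).coeFn_toLp 2 volume] with x hx
    simp [hx, mul_comm]
  have e2 : ∫ x, inner ℂ ((SchwartzMap.derivCLM ℂ ℂ (schwartzConj φ)).toLp 2 volume x) (p.snd x)
      = ∫ x, deriv φ x * p.snd x := by
    refine integral_congr_ae ?_
    filter_upwards [(SchwartzMap.derivCLM ℂ ℂ (schwartzConj φ)).coeFn_toLp 2 volume] with x hx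
    rw [hx]
    simp [deriv_schwartzConj, mul_comm]
  have h' : (∫ x, φ x * p.fst x) + ∫ x, deriv φ x * p.snd x = 0 := by
    rw [← e1, ← e2]; exact h
  linear_combination h'

/-- Schwartz functions are dense in `H¹` for the graph norm: a pair `(u, v)` of the graph that is
orthogonal to all of them satisfies `u' = v` and `v' = u`, hence vanishes. -/
theorem IsWeakDeriv.exists_schwartz_tendsto {f g : L2} (h : IsWeakDeriv f g) :
    ∃ φ : ℕ → 𝓢(ℝ, ℂ), Tendsto (fun n => (φ n).toLp 2) atTop (𝓝 f) ∧
      Tendsto (fun n => (SchwartzMap.derivCLM ℂ ℂ (φ n)).toLp 2) atTop (𝓝 g) := by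
  set K := schwartzGraph.topologicalClosure
  have hKc : IsClosed (K : Set (WithLp 2 (L2 × L2))) := schwartzGraph.isClosed_topologicalClosure
  have : CompleteSpace K := hKc.completeSpace_coe
  have hK : ∀ q ∈ K, IsWeakDeriv q.fst q.snd := by
    intro q hq
    have hcl : IsClosed {q : WithLp 2 (L2 × L2) | IsWeakDeriv q.fst q.snd} :=
      isClosed_isWeakDeriv.preimage (f := fun q : WithLp 2 (L2 × L2) => (q.fst, q.snd))
        (WithLp.prod_continuous_ofLp 2 L2 L2)
    refine closure_minimal ?_ hcl hq
    rintro _ ⟨φ, rfl⟩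
    exact IsWeakDeriv.schwartz φ
  let p : WithLp 2 (L2 × L2) := WithLp.toLp 2 (f, g)
  obtain ⟨y, hy, z, hz, hyz⟩ := K.exists_add_mem_mem_orthogonal p
  have hz' : z ∈ schwartzGraphᗮ := Submodule.orthogonal_le schwartzGraph.le_topologicalClosure hz
  have h1 : IsWeakDeriv z.snd z.fst := isWeakDeriv_swap_of_mem_orthogonal hz'
  have h2 : IsWeakDeriv z.fst z.snd := by
    have e : z = p + (-1 : ℂ) • y := by rw [hyz]; simp
    rw [e]
    exact isWeakDeriv_add h (isWeakDeriv_smul (-1) (hK y hy))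
  have hz0 : z = 0 := by
    have a := h2.eq_zero_of_symm h1
    have b := h1.eq_zero_of_symm h2
    exact (WithLp.ofLp_injective 2) (Prod.ext a b)
  have hpK : p ∈ closure (schwartzGraph : Set (WithLp 2 (L2 × L2))) := by
    rw [hyz, hz0, add_zero]; exact hy
  obtain ⟨u, hu, hup⟩ := mem_closure_iff_seq_limit.1 hpK
  choose φ hφ using fun n => mem_schwartzGraph.1 (hu n)
  have hcont := ((WithLp.prod_continuous_ofLp 2 L2 L2).tendsto p).comp hup
  refine ⟨φ, ?_, ?_⟩
  · refine ((continuous_fst.tendsto _).comp hcont).congr fun n => ?_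
    simp only [Function.comp, ← hφ n]
  · refine ((continuous_snd.tendsto _).comp hcont).congr fun n => ?_
    simp only [Function.comp, ← hφ n]

/-! ### One-dimensional Sobolev bound and product rule -/

theorem L2.integral_norm_sq (f : L2) : ∫ x, ‖f x‖ ^ 2 = ‖f‖ ^ 2 := by
  have h : ((∫ x, ‖f x‖ ^ 2 : ℝ) : ℂ) = ((‖f‖ ^ 2 : ℝ) : ℂ) := by
    have := inner_self_eq_norm_sq_to_K (𝕜 := ℂ) f
    rw [L2.inner_def] at this
    rw [← integral_complex_ofReal]
    simpa [inner_self_eq_norm_sq_to_K] using this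
  exact_mod_cast h

theorem L2.integrable_norm_sq (f : L2) : Integrable fun x => ‖f x‖ ^ 2 :=
  (memLp_two_iff_integrable_sq_norm (Lp.aestronglyMeasurable f)).1 (Lp.memLp f)

/-- Along a sequence converging in `L²`, some subsequence converges almost everywhere. -/
theorem L2.exists_subseq_tendsto_ae {u : ℕ → L2} {f : L2} (h : Tendsto u atTop (𝓝 f)) :
    ∃ ns : ℕ → ℕ, StrictMono ns ∧ ∀ᵐ x, Tendsto (fun i => u (ns i) x) atTop (𝓝 (f x)) :=
  (tendstoInMeasure_of_tendsto_Lp h).exists_seq_tendsto_ae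

/-- The Sobolev bound for Schwartz functions, from `|φ(x)|² = ∫_{-∞}^x 2 Re(φ̄ φ')`. -/
theorem schwartz_norm_le (φ : 𝓢(ℝ, ℂ)) (x : ℝ) :
    ‖φ x‖ ≤ ‖φ.toLp 2‖ + ‖(SchwartzMap.derivCLM ℂ ℂ φ).toLp 2‖ := by
  set ψ := SchwartzMap.derivCLM ℂ ℂ φ
  have hd : ∀ y, HasDerivAt (fun y => ‖φ y‖ ^ 2) (2 * inner ℝ (φ y) (ψ y)) y := fun y => by
    have := (φ.hasDerivAt y).norm_sq
    simpa [ψ] using this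
  have i1 : Integrable fun y => ‖φ y‖ ^ 2 :=
    (memLp_two_iff_integrable_sq_norm φ.continuous.aestronglyMeasurable).1 (φ.memLp 2 volume)
  have i2 : Integrable fun y => ‖ψ y‖ ^ 2 :=
    (memLp_two_iff_integrable_sq_norm ψ.continuous.aestronglyMeasurable).1 (ψ.memLp 2 volume)
  have hb : ∀ y, ‖2 * inner ℝ (φ y) (ψ y)‖ ≤ ‖φ y‖ ^ 2 + ‖ψ y‖ ^ 2 := fun y => by
    rw [norm_mul, Real.norm_ofNat]
    have := norm_inner_le_norm (𝕜 := ℝ) (φ y) (ψ y)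
    nlinarith [sq_nonneg (‖φ y‖ - ‖ψ y‖)]
  have i3 : Integrable fun y => 2 * inner ℝ (φ y) (ψ y) := by
    refine (i1.add i2).mono' ?_ (.of_forall hb)
    exact (continuous_const.mul (φ.continuous.inner ψ.continuous)).aestronglyMeasurable
  have hlim : Tendsto (fun y => ‖φ y‖ ^ 2) atBot (𝓝 0) := by
    have h0 : Tendsto φ atBot (𝓝 0) :=
      (φ.toZeroAtInfty.zero_at_infty').mono_left atBot_le_cocompact
    simpa using (h0.norm).pow 2
  have e := integral_Iic_of_hasDerivAt_of_tendsto' (a := x) (fun y _ => hd y) i3.integrableOn hlim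
  have n1 : ∫ y, ‖φ y‖ ^ 2 = ‖φ.toLp 2‖ ^ 2 := by
    rw [← L2.integral_norm_sq]
    refine integral_congr_ae ?_
    filter_upwards [φ.coeFn_toLp 2 volume] with y hy
    rw [hy]
  have n2 : ∫ y, ‖ψ y‖ ^ 2 = ‖ψ.toLp 2‖ ^ 2 := by
    rw [← L2.integral_norm_sq]
    refine integral_congr_ae ?_
    filter_upwards [ψ.coeFn_toLp 2 volume] with y hy
    rw [hy]
  have hsq : ‖φ x‖ ^ 2 ≤ ‖φ.toLp 2‖ ^ 2 + ‖ψ.toLp 2‖ ^ 2 := by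
    calc ‖φ x‖ ^ 2 = ∫ y in Iic x, 2 * inner ℝ (φ y) (ψ y) := by rw [e, sub_zero]
      _ ≤ ∫ y in Iic x, (‖φ y‖ ^ 2 + ‖ψ y‖ ^ 2) :=
        integral_mono i3.integrableOn (i1.fun_add i2).integrableOn
          fun y => (le_abs_self _).trans (hb y)
      _ ≤ ∫ y, (‖φ y‖ ^ 2 + ‖ψ y‖ ^ 2) :=
        setIntegral_le_integral (i1.add i2) (.of_forall fun y => by positivity)
      _ = _ := by rw [integral_add i1 i2, n1, n2]
  refine abs_le_of_sq_le_sq' ?_ (by positivity) |>.2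
  nlinarith [norm_nonneg (φ.toLp 2), norm_nonneg (ψ.toLp 2)]

/-- The embedding `H¹ ⊂ L^∞`. -/
theorem IsWeakDeriv.norm_le {f g : L2} (h : IsWeakDeriv f g) : ∀ᵐ x, ‖f x‖ ≤ ‖f‖ + ‖g‖ := by
  obtain ⟨φ, hf, hg⟩ := h.exists_schwartz_tendsto
  obtain ⟨ns, hns, hae⟩ := L2.exists_subseq_tendsto_ae hf
  have hc : ∀ᵐ x, ∀ n, (φ n).toLp 2 volume x = φ n x := ae_all_iff.2 fun n =>
    (φ n).coeFn_toLp 2 volume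
  filter_upwards [hae, hc] with x hx hcx
  refine le_of_tendsto_of_tendsto' hx.norm
    ((hf.norm.add hg.norm).comp hns.tendsto_atTop) fun n => ?_
  rw [hcx]
  exact schwartz_norm_le _ x

/-- For a fixed bounded weight `Φ`, the pairing `∫ Φ f g` is continuous on `L² × L²`. -/
theorem L2.tendsto_integral_mul_mul {Φ : ℝ → ℂ} (hΦ : MemLp Φ ∞ volume) {u v : ℕ → L2} {f g : L2}
    (hu : Tendsto u atTop (𝓝 f)) (hv : Tendsto v atTop (𝓝 g)) :
    Tendsto (fun n => ∫ x, Φ x * (u n x * v n x)) atTop (𝓝 (∫ x, Φ x * (f x * g x))) := by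
  have hcont : ∀ (A : L2 →L[ℂ] L2) (Q : L2 →L[ℂ] L2 →L[ℂ] ℂ),
      Continuous fun p : L2 × L2 => Q (A p.1) p.2 := fun A Q => by fun_prop
  have key : ∃ (A : L2 →L[ℂ] L2) (Q : L2 →L[ℂ] L2 →L[ℂ] ℂ),
      ∀ a b : L2, ∫ x, Φ x * (a x * b x) = Q (A a) b := by
    refine ⟨(ContinuousLinearMap.mul ℂ ℂ).holderL volume ∞ 2 2 (hΦ.toLp Φ),
      (ContinuousLinearMap.mul ℂ ℂ).lpPairing volume 2 2, fun a b => ?_⟩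
    rw [ContinuousLinearMap.lpPairing_eq_integral]
    refine integral_congr_ae ?_
    filter_upwards [(ContinuousLinearMap.mul ℂ ℂ).coeFn_holder (r := 2) (hΦ.toLp Φ) a,
      hΦ.coeFn_toLp] with x h1 h2
    refine Eq.trans ?_ (congrArg (· * b x) h1.symm)
    simp [h2, mul_assoc]
  obtain ⟨A, Q, hAQ⟩ := key
  simp_rw [hAQ]
  exact ((hcont A Q).tendsto (f, g)).comp (hu.prodMk_nhds hv)

/-- The product rule in `H¹`. -/
theorem IsWeakDeriv.mul {f f' g g' p q : L2} (hf : IsWeakDeriv f f') (hg : IsWeakDeriv g g')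
    (hp : p =ᵐ[volume] fun x => f x * g x) (hq : q =ᵐ[volume] fun x => f' x * g x + f x * g' x) :
    IsWeakDeriv p q := by
  obtain ⟨φ, hφ, hφ'⟩ := hf.exists_schwartz_tendsto
  obtain ⟨ψ, hψ, hψ'⟩ := hg.exists_schwartz_tendsto
  rw [isWeakDeriv_iff_integral]
  intro χ
  have mχ : MemLp χ ∞ volume := χ.memLp_top volume
  have mχ' : MemLp (fun x => deriv χ x) ∞ volume := (SchwartzMap.derivCLM ℂ ℂ χ).memLp_top volume
  have int : ∀ {Φ : ℝ → ℂ}, MemLp Φ ∞ volume → ∀ a b : L2, Integrable fun x => Φ x * (a x * b x) :=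
    fun hΦ a b => ((Lp.memLp a).integrable_mul (Lp.memLp b)).mul_of_top_right hΦ
  have e1 : ∫ x, deriv χ x * p x = ∫ x, deriv χ x * (f x * g x) := by
    refine integral_congr_ae ?_
    filter_upwards [hp] with x hx
    rw [hx]
  have e2 : ∫ x, χ x * q x = (∫ x, χ x * (f' x * g x)) + ∫ x, χ x * (f x * g' x) := by
    rw [← integral_add (int mχ _ _) (int mχ _ _)]
    refine integral_congr_ae ?_
    filter_upwards [hq] with x hx
    rw [hx, mul_add]
  rw [e1, e2]
  have l1 := L2.tendsto_integral_mul_mul mχ' hφ hψ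
  have l2 := ((L2.tendsto_integral_mul_mul mχ hφ' hψ).add
    (L2.tendsto_integral_mul_mul mχ hφ hψ')).neg
  refine tendsto_nhds_unique l1 (l2.congr fun n => ?_)
  -- For Schwartz functions this is integration by parts against the product `φ ψ`.
  set a := φ n
  set b := ψ n
  set a' := SchwartzMap.derivCLM ℂ ℂ a
  set b' := SchwartzMap.derivCLM ℂ ℂ b
  have ca := a.coeFn_toLp 2 volume
  have cb := b.coeFn_toLp 2 volume
  have ca' := a'.coeFn_toLp 2 volume
  have cb' := b'.coeFn_toLp 2 volume
  rw [← integral_add (int mχ _ _) (int mχ _ _)]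
  have s1 : ∫ x, (χ x * (a'.toLp 2 volume x * b.toLp 2 volume x)
      + χ x * (a.toLp 2 volume x * b'.toLp 2 volume x)) =
      ∫ x, (a' x * b x + a x * b' x) * χ x := by
    refine integral_congr_ae ?_
    filter_upwards [ca, cb, ca', cb'] with x h1 h2 h3 h4
    rw [h1, h2, h3, h4]; ring
  have s2 : ∫ x, deriv χ x * (a.toLp 2 volume x * b.toLp 2 volume x) =
      ∫ x, (a x * b x) * deriv χ x := by
    refine integral_congr_ae ?_
    filter_upwards [ca, cb] with x h1 h2
    rw [h1, h2]; ring
  rw [s1, s2]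
  have hab : MemLp (fun x => a x * b x) 2 volume := (b.memLp 2 volume).mul (a.memLp_top volume)
  have hab' : MemLp (fun x => a' x * b x + a x * b' x) 2 volume :=
    ((b.memLp 2 volume).mul (a'.memLp_top volume)).add ((b'.memLp 2 volume).mul (a.memLp_top volume))
  have mχ2 : MemLp χ 2 volume := χ.memLp 2 volume
  have mχ2' : MemLp (fun x => deriv χ x) 2 volume := (SchwartzMap.derivCLM ℂ ℂ χ).memLp 2 volume
  exact (integral_mul_deriv_eq_deriv_mul_of_integrable
    (fun x _ => (a.hasDerivAt x).mul (b.hasDerivAt x))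
    (fun x _ => χ.hasDerivAt x) (hab.integrable_mul mχ2') (hab'.integrable_mul mχ2)
    (hab.integrable_mul mχ2)).symm

/-! ### The spaces `H^k` -/

namespace Hk

variable {k : ℕ}

theorem toL2_add (u v : Hk k) : toL2 (u + v) = toL2 u + toL2 v := rfl

theorem toL2_sub (u v : Hk k) : toL2 (u - v) = toL2 u - toL2 v := rfl

theorem toL2_smul (c : ℂ) (u : Hk k) : toL2 (c • u) = c • toL2 u := rfl

theorem coeFn_add (u v : Hk k) : toL2 (u + v) =ᵐ[volume] fun x => toL2 u x + toL2 v x :=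
  Lp.coeFn_add _ _

theorem coeFn_sub (u v : Hk k) : toL2 (u - v) =ᵐ[volume] fun x => toL2 u x - toL2 v x :=
  Lp.coeFn_sub _ _

theorem coeFn_smul (c : ℂ) (u : Hk k) : toL2 (c • u) =ᵐ[volume] fun x => c * toL2 u x :=
  Lp.coeFn_smul _ _

theorem norm_sq_eq (u : Hk k) :
    ‖u‖ ^ 2 = ∑ i, ‖(u : PiLp 2 (fun _ : Fin (k + 1) => L2)) i‖ ^ 2 :=
  PiLp.norm_sq_eq_of_L2 _ _

/-- The entries of an element of `H^k` are determined by its underlying function. -/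
theorem toL2_injective : Function.Injective (toL2 : Hk k → L2) := by
  intro u v h
  refine Subtype.ext (PiLp.ext fun i => ?_)
  induction i using Fin.induction with
  | zero => exact h
  | succ i ih =>
    have hu := u.2 i
    rw [ih] at hu
    exact hu.unique (v.2 i)

theorem ext_ae {u v : Hk k} (h : toL2 u =ᵐ[volume] toL2 v) : u = v :=
  toL2_injective (Lp.ext h)

/-- The inclusion `H^k ⊂ L²` as a bounded operator. -/
def toL2L (k : ℕ) : Hk k →L[ℂ] L2 :=
  (PiLp.proj 2 (fun _ : Fin (k + 1) => L2) (0 : Fin (k + 1))).comp (Hk k).subtypeL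

theorem toL2L_apply (u : Hk k) : toL2L k u = toL2 u := rfl

theorem norm_toL2_le (u : Hk k) : ‖toL2 u‖ ≤ ‖u‖ :=
  PiLp.norm_apply_le (u : PiLp 2 (fun _ : Fin (k + 1) => L2)) 0

instance : CompleteSpace (Hk k) := by
  have h : (Hk k : Set (PiLp 2 (fun _ : Fin (k + 1) => L2))) =
      ⋂ i : Fin k, (fun u => (u i.castSucc, u i.succ)) ⁻¹' {p : L2 × L2 | IsWeakDeriv p.1 p.2} := by
    ext u
    simp [Hk]
  have hc : IsClosed (Hk k : Set (PiLp 2 (fun _ : Fin (k + 1) => L2))) := by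
    rw [h]
    exact isClosed_iInter fun i => isClosed_isWeakDeriv.preimage (by fun_prop)
  exact hc.completeSpace_coe

/-- Differentiation `H^(k+1) → H^k`. -/
def tail (u : Hk (k + 1)) : Hk k :=
  ⟨WithLp.toLp 2 fun i => (u : PiLp 2 (fun _ : Fin (k + 2) => L2)) i.succ, fun i => u.2 i.succ⟩

/-- The inclusion `H^(k+1) ⊂ H^k`. -/
def init (u : Hk (k + 1)) : Hk k :=
  ⟨WithLp.toLp 2 fun i => (u : PiLp 2 (fun _ : Fin (k + 2) => L2)) i.castSucc,
    fun i => u.2 i.castSucc⟩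

theorem toL2_init (u : Hk (k + 1)) : toL2 (init u) = toL2 u := rfl

theorem isWeakDeriv_tail (u : Hk (k + 1)) : IsWeakDeriv (toL2 u) (toL2 (tail u)) := u.2 0

theorem norm_sq_eq_tail (u : Hk (k + 1)) : ‖u‖ ^ 2 = ‖toL2 u‖ ^ 2 + ‖tail u‖ ^ 2 := by
  rw [norm_sq_eq, norm_sq_eq, Fin.sum_univ_succ]
  rfl

theorem norm_tail_le (u : Hk (k + 1)) : ‖tail u‖ ≤ ‖u‖ :=
  (sq_le_sq₀ (norm_nonneg _) (norm_nonneg _)).1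
    (by rw [norm_sq_eq_tail u]; nlinarith [sq_nonneg ‖toL2 u‖])

theorem norm_init_le (u : Hk (k + 1)) : ‖init u‖ ≤ ‖u‖ := by
  refine (sq_le_sq₀ (norm_nonneg _) (norm_nonneg _)).1 ?_
  rw [norm_sq_eq, norm_sq_eq, Fin.sum_univ_castSucc (n := k + 1)]
  exact le_add_of_nonneg_right (sq_nonneg _)

/-- The element of `H^(k+1)` given by a function together with its weak derivative in `H^k`. -/
def cons (f : L2) (w : Hk k) (h : IsWeakDeriv f (toL2 w)) : Hk (k + 1) :=
  ⟨WithLp.toLp 2 (Fin.cons f fun i => (w : PiLp 2 (fun _ : Fin (k + 1) => L2)) i), by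
    intro i
    induction i using Fin.cases with
    | zero => exact h
    | succ i => exact w.2 i⟩

theorem norm_cons_le (f : L2) (w : Hk k) (h : IsWeakDeriv f (toL2 w)) :
    ‖cons f w h‖ ≤ ‖f‖ + ‖w‖ := by
  have e : ‖cons f w h‖ ^ 2 = ‖f‖ ^ 2 + ‖w‖ ^ 2 := norm_sq_eq_tail _
  refine (sq_le_sq₀ (norm_nonneg _) (by positivity)).1 ?_
  rw [e]
  nlinarith [mul_nonneg (norm_nonneg f) (norm_nonneg w)]

/-- `L²` regarded as `H⁰`. -/
def ofL2 (f : L2) : Hk 0 := ⟨WithLp.toLp 2 fun _ => f, fun i => i.elim0⟩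

theorem toL2_ofL2 (f : L2) : toL2 (ofL2 f) = f := rfl

theorem norm_ofL2 (f : L2) : ‖ofL2 f‖ = ‖f‖ := by
  have : ‖ofL2 f‖ ^ 2 = ‖f‖ ^ 2 := by rw [norm_sq_eq]; simp [ofL2]
  exact (sq_eq_sq₀ (norm_nonneg _) (norm_nonneg _)).1 this

/-- The embedding `H^(k+1) ⊂ L^∞`. -/
theorem norm_apply_le (u : Hk (k + 1)) : ∀ᵐ x, ‖toL2 u x‖ ≤ 2 * ‖u‖ := by
  filter_upwards [(isWeakDeriv_tail u).norm_le] with x hx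
  linarith [norm_toL2_le u, norm_toL2_le (tail u), norm_tail_le u]

/-- The action on `H^k` of an additive map of `L²` commuting with differentiation. -/
def map (A : L2 →+ L2) (hA : ∀ f g, IsWeakDeriv f g → IsWeakDeriv (A f) (A g)) : Hk k →+ Hk k where
  toFun u := ⟨WithLp.toLp 2 fun i => A ((u : PiLp 2 (fun _ : Fin (k + 1) => L2)) i),
    fun i => hA _ _ (u.2 i)⟩
  map_zero' := Subtype.ext (PiLp.ext fun _ => map_zero A)
  map_add' _ _ := Subtype.ext (PiLp.ext fun _ => map_add A _ _)

theorem toL2_map (A : L2 →+ L2) (hA : ∀ f g, IsWeakDeriv f g → IsWeakDeriv (A f) (A g))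
    (u : Hk k) : toL2 (map A hA u) = A (toL2 u) := rfl

theorem norm_map (A : L2 →+ L2) (hA : ∀ f g, IsWeakDeriv f g → IsWeakDeriv (A f) (A g))
    (hn : ∀ f, ‖A f‖ = ‖f‖) (u : Hk k) : ‖map A hA u‖ = ‖u‖ := by
  have : ‖map A hA u‖ ^ 2 = ‖u‖ ^ 2 := by
    rw [norm_sq_eq, norm_sq_eq]
    exact Finset.sum_congr rfl fun i _ => congrArg (· ^ 2) (hn _)
  exact (sq_eq_sq₀ (norm_nonneg _) (norm_nonneg _)).1 this

end Hk

/-- The product of a bounded function with an `L²` function. -/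
theorem L2.exists_mul_of_bdd {e : ℝ → ℂ} {a : ℝ} (he : AEStronglyMeasurable e volume)
    (ha : ∀ᵐ x, ‖e x‖ ≤ a) (f : L2) :
    ∃ p : L2, (p =ᵐ[volume] fun x => e x * f x) ∧ ‖p‖ ≤ a * ‖f‖ := by
  have hb : ∀ᵐ x, ‖e x * f x‖ ≤ a * ‖f x‖ := by
    filter_upwards [ha] with x hx
    rw [norm_mul]
    gcongr
  have hm : MemLp (fun x => e x * f x) 2 volume :=
    (Lp.memLp f).of_le_mul (he.mul (Lp.aestronglyMeasurable f)) hb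
  refine ⟨hm.toLp _, hm.coeFn_toLp, Lp.norm_le_mul_norm_of_ae_le_mul ?_⟩
  filter_upwards [hm.coeFn_toLp, hb] with x h1 h2
  rwa [h1]

namespace Hk

variable {k : ℕ}

/-- The `H¹` product estimate, linear in the `H¹` norms when sup bounds are given. -/
theorem exists_mul_one {u v : Hk 1} {a b : ℝ} (ha : ∀ᵐ x, ‖toL2 u x‖ ≤ a)
    (hb : ∀ᵐ x, ‖toL2 v x‖ ≤ b) :
    ∃ w : Hk 1, (toL2 w =ᵐ[volume] fun x => toL2 u x * toL2 v x) ∧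
      ‖w‖ ≤ 2 * (a * ‖v‖ + b * ‖u‖) := by
  have mu := Lp.aestronglyMeasurable (toL2 u)
  have mv := Lp.aestronglyMeasurable (toL2 v)
  obtain ⟨p, hp, np⟩ := L2.exists_mul_of_bdd mu ha (toL2 v)
  obtain ⟨q, hq, nq⟩ := L2.exists_mul_of_bdd mu ha (toL2 (tail v))
  obtain ⟨r, hr, nr⟩ := L2.exists_mul_of_bdd mv hb (toL2 (tail u))
  have hd : IsWeakDeriv p (toL2 (ofL2 (r + q))) := by
    refine (isWeakDeriv_tail u).mul (isWeakDeriv_tail v) hp ?_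
    filter_upwards [hq, hr, Lp.coeFn_add r q] with x h1 h2 h3
    rw [toL2_ofL2, h3, Pi.add_apply, h1, h2]
    ring
  have ha0 : 0 ≤ a := (ha.exists).elim fun x hx => (norm_nonneg _).trans hx
  have hb0 : 0 ≤ b := (hb.exists).elim fun x hx => (norm_nonneg _).trans hx
  refine ⟨cons p (ofL2 (r + q)) hd, hp, (norm_cons_le _ _ _).trans ?_⟩
  rw [norm_ofL2]
  have h1 := norm_add_le r q
  have h2 : a * ‖toL2 v‖ ≤ a * ‖v‖ := by gcongr; exact norm_toL2_le v
  have h3 : a * ‖toL2 (tail v)‖ ≤ a * ‖v‖ := by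
    gcongr; exact (norm_toL2_le _).trans (norm_tail_le v)
  have h4 : b * ‖toL2 (tail u)‖ ≤ b * ‖u‖ := by
    gcongr; exact (norm_toL2_le _).trans (norm_tail_le u)
  have h5 : 0 ≤ b * ‖u‖ := by positivity
  linarith

/-- If `H^(k+1)` is an algebra, then `H^(k+2)` is one and the product is tame: each term of the
estimate contains the top norm of only one factor. -/
theorem exists_mul_succ {C : ℝ} (hC : 0 ≤ C)
    (h : ∀ u v : Hk (k + 1), ∃ w : Hk (k + 1), (toL2 w =ᵐ[volume] fun x => toL2 u x * toL2 v x) ∧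
      ‖w‖ ≤ C * (‖u‖ * ‖v‖)) (u v : Hk (k + 2)) :
    ∃ w : Hk (k + 2), (toL2 w =ᵐ[volume] fun x => toL2 u x * toL2 v x) ∧
      ‖w‖ ≤ (C + 2) * (‖init u‖ * ‖v‖ + ‖init v‖ * ‖u‖) := by
  obtain ⟨p, hp, np⟩ := L2.exists_mul_of_bdd (Lp.aestronglyMeasurable (toL2 u))
    (norm_apply_le (init u)) (toL2 v)
  obtain ⟨q, hq, nq⟩ := h (tail u) (init v)
  obtain ⟨r, hr, nr⟩ := h (init u) (tail v)
  have hd : IsWeakDeriv p (toL2 (q + r)) := by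
    refine (isWeakDeriv_tail u).mul (isWeakDeriv_tail v) hp ?_
    filter_upwards [hq, hr, coeFn_add q r] with x h1 h2 h3
    rw [h3, h1, h2]
    rfl
  refine ⟨cons p (q + r) hd, hp, (norm_cons_le _ _ _).trans ?_⟩
  have h1 := norm_add_le q r
  have h2 : 2 * ‖init u‖ * ‖toL2 v‖ ≤ 2 * ‖init u‖ * ‖v‖ := by gcongr; exact norm_toL2_le v
  have h3 : C * (‖tail u‖ * ‖init v‖) ≤ C * (‖u‖ * ‖init v‖) := by gcongr; exact norm_tail_le u
  have h4 : C * (‖init u‖ * ‖tail v‖) ≤ C * (‖init u‖ * ‖v‖) := by gcongr; exact norm_tail_le v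
  have h5 : 0 ≤ ‖init v‖ * ‖u‖ := by positivity
  nlinarith

/-- `H^(k+1)` is an algebra under pointwise multiplication. -/
theorem exists_mul (k : ℕ) : ∃ C : ℝ, 0 ≤ C ∧ ∀ u v : Hk (k + 1), ∃ w : Hk (k + 1),
    (toL2 w =ᵐ[volume] fun x => toL2 u x * toL2 v x) ∧ ‖w‖ ≤ C * (‖u‖ * ‖v‖) := by
  induction k with
  | zero =>
    refine ⟨8, by norm_num, fun u v => ?_⟩
    obtain ⟨w, hw, nw⟩ := exists_mul_one (norm_apply_le u) (norm_apply_le v)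
    exact ⟨w, hw, nw.trans (le_of_eq (by ring))⟩
  | succ k ih =>
    obtain ⟨C, hC, h⟩ := ih
    refine ⟨2 * (C + 2), by positivity, fun u v => ?_⟩
    obtain ⟨w, hw, nw⟩ := exists_mul_succ hC h u v
    refine ⟨w, hw, nw.trans ?_⟩
    have h1 : ‖init u‖ * ‖v‖ ≤ ‖u‖ * ‖v‖ := by gcongr; exact norm_init_le u
    have h2 : ‖init v‖ * ‖u‖ ≤ ‖v‖ * ‖u‖ := by gcongr; exact norm_init_le v
    nlinarith

/-- Pointwise multiplication on `H^(k+1)`. -/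
def mul (u v : Hk (k + 1)) : Hk (k + 1) := ((exists_mul k).choose_spec.2 u v).choose

theorem coeFn_mul (u v : Hk (k + 1)) :
    toL2 (mul u v) =ᵐ[volume] fun x => toL2 u x * toL2 v x :=
  ((exists_mul k).choose_spec.2 u v).choose_spec.1

theorem exists_norm_mul_le (k : ℕ) :
    ∃ C : ℝ, 0 ≤ C ∧ ∀ u v : Hk (k + 1), ‖mul u v‖ ≤ C * (‖u‖ * ‖v‖) :=
  ⟨_, (exists_mul k).choose_spec.1, fun u v =>
    ((exists_mul k).choose_spec.2 u v).choose_spec.2⟩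

theorem mul_sub_mul (u v u' v' : Hk (k + 1)) :
    mul u v - mul u' v' = mul (u - u') v + mul u' (v - v') := by
  refine ext_ae ?_
  filter_upwards [coeFn_sub (mul u v) (mul u' v'), coeFn_add (mul (u - u') v) (mul u' (v - v')),
    coeFn_mul u v, coeFn_mul u' v', coeFn_mul (u - u') v, coeFn_mul u' (v - v'), coeFn_sub u u',
    coeFn_sub v v'] with x h1 h2 h3 h4 h5 h6 h7 h8
  rw [h1, h2, h3, h4, h5, h6, h7, h8]
  ring

theorem init_mul (u v : Hk (k + 2)) : init (mul u v) = mul (init u) (init v) :=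
  ext_ae ((coeFn_mul u v).trans (coeFn_mul (init u) (init v)).symm)

theorem norm_mul_one_le {u v : Hk 1} {a b : ℝ} (ha : ∀ᵐ x, ‖toL2 u x‖ ≤ a)
    (hb : ∀ᵐ x, ‖toL2 v x‖ ≤ b) : ‖mul u v‖ ≤ 2 * (a * ‖v‖ + b * ‖u‖) := by
  obtain ⟨w, hw, nw⟩ := exists_mul_one ha hb
  rwa [ext_ae ((coeFn_mul u v).trans hw.symm)]

theorem exists_norm_mul_tame_le (k : ℕ) : ∃ C : ℝ, 0 ≤ C ∧
    ∀ u v : Hk (k + 2), ‖mul u v‖ ≤ C * (‖init u‖ * ‖v‖ + ‖init v‖ * ‖u‖) := by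
  obtain ⟨C, hC, h⟩ := exists_mul k
  refine ⟨C + 2, by positivity, fun u v => ?_⟩
  obtain ⟨w, hw, nw⟩ := exists_mul_succ hC h u v
  rwa [ext_ae ((coeFn_mul u v).trans hw.symm)]

end Hk

/-- To show that a continuous operation on `H¹` produces a weak derivative, it suffices to treat
Schwartz functions. -/
theorem IsWeakDeriv.of_schwartz {A : L2 → L2} {B : L2 × L2 → L2} (hA : Continuous A)
    (hB : Continuous B)
    (h : ∀ φ : 𝓢(ℝ, ℂ), IsWeakDeriv (A (φ.toLp 2))
      (B (φ.toLp 2, (SchwartzMap.derivCLM ℂ ℂ φ).toLp 2)))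
    {f g : L2} (hfg : IsWeakDeriv f g) : IsWeakDeriv (A f) (B (f, g)) := by
  obtain ⟨φ, hf, hg⟩ := hfg.exists_schwartz_tendsto
  have h1 : Tendsto (fun n => A ((φ n).toLp 2)) atTop (𝓝 (A f)) := (hA.tendsto f).comp hf
  have h2 : Tendsto (fun n => B ((φ n).toLp 2, (SchwartzMap.derivCLM ℂ ℂ (φ n)).toLp 2)) atTop
      (𝓝 (B (f, g))) := (hB.tendsto (f, g)).comp (hf.prodMk_nhds hg)
  have h3 := h1.prodMk_nhds h2
  have h4 : (A f, B (f, g)) ∈ {p : L2 × L2 | IsWeakDeriv p.1 p.2} :=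
    isClosed_isWeakDeriv.mem_of_tendsto h3 (Eventually.of_forall fun n => h (φ n))
  exact h4

/-! ### Conjugation and multiplication by the background -/

/-- Complex conjugation on `L²`. -/
def L2.conj : L2 →+ L2 :=
  ((Complex.conjCLE : ℂ →L[ℝ] ℂ).compLpL 2 volume).toLinearMap.toAddMonoidHom

theorem L2.coeFn_conj (f : L2) : L2.conj f =ᵐ[volume] fun x => (starRingEnd ℂ) (f x) :=
  (Complex.conjCLE : ℂ →L[ℝ] ℂ).coeFn_compLpL f

theorem L2.continuous_conj : Continuous L2.conj :=
  ((Complex.conjCLE : ℂ →L[ℝ] ℂ).compLpL 2 volume).continuous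

theorem L2.norm_conj (f : L2) : ‖L2.conj f‖ = ‖f‖ := by
  rw [Lp.norm_def, Lp.norm_def]
  congr 1
  refine eLpNorm_congr_norm_ae ?_
  filter_upwards [L2.coeFn_conj f] with x hx
  rw [hx, RCLike.norm_conj]

theorem IsWeakDeriv.conj (f g : L2) (h : IsWeakDeriv f g) :
    IsWeakDeriv (L2.conj f) (L2.conj g) := by
  refine IsWeakDeriv.of_schwartz (B := fun p => L2.conj p.2) L2.continuous_conj
    (L2.continuous_conj.comp continuous_snd) (fun φ => ?_) h
  refine .of_hasDerivAt (F := schwartzConj φ) (fun x => (schwartzConj φ).hasDerivAt x) ?_ ?_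
  · filter_upwards [L2.coeFn_conj (φ.toLp 2), φ.coeFn_toLp 2 volume] with x h1 h2
    rw [h1, h2, schwartzConj_apply]
  · filter_upwards [L2.coeFn_conj ((SchwartzMap.derivCLM ℂ ℂ φ).toLp 2),
      (SchwartzMap.derivCLM ℂ ℂ φ).coeFn_toLp 2 volume] with x h1 h2
    rw [h1, h2, deriv_schwartzConj, SchwartzMap.derivCLM_apply]

theorem norm_background (R : ℂ) (κ ξ : ℝ) : ‖background R κ ξ‖ = ‖R‖ := by
  have : -(Complex.I * (κ : ℂ) * (ξ : ℂ)) = ((-(κ * ξ) : ℝ) : ℂ) * Complex.I := by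
    push_cast; ring
  rw [background, norm_mul, this, Complex.norm_exp_ofReal_mul_I, mul_one]

theorem conj_background (R : ℂ) (κ ξ : ℝ) :
    (starRingEnd ℂ) (background R κ ξ) = background ((starRingEnd ℂ) R) (-κ) ξ := by
  rw [background, background, map_mul, ← Complex.exp_conj]
  simp

theorem hasDerivAt_background (R : ℂ) (κ ξ : ℝ) :
    HasDerivAt (background R κ) (-(Complex.I * κ) * background R κ ξ) ξ := by
  have h1 : HasDerivAt (fun y : ℝ => -(Complex.I * (κ : ℂ) * (y : ℂ))) (-(Complex.I * κ)) ξ := by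
    simpa using ((Complex.ofRealCLM.hasDerivAt (x := ξ)).const_mul (Complex.I * (κ : ℂ))).fun_neg
  have h2 := (h1.cexp).const_mul R
  refine h2.congr_deriv ?_
  rw [background]
  ring

theorem continuous_background (R : ℂ) (κ : ℝ) : Continuous (background R κ) := by
  unfold background
  fun_prop

theorem background_memLp (R : ℂ) (κ : ℝ) : MemLp (background R κ) ∞ volume :=
  memLp_top_of_bound (continuous_background R κ).aestronglyMeasurable ‖R‖
    (.of_forall fun x => (norm_background R κ x).le)

/-- Multiplication by the background `R exp (-iκξ)` on `L²`. -/
def L2.mulBackground (R : ℂ) (κ : ℝ) : L2 →L[ℂ] L2 :=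
  (ContinuousLinearMap.mul ℂ ℂ).holderL volume ∞ 2 2 ((background_memLp R κ).toLp _)

theorem L2.coeFn_mulBackground (R : ℂ) (κ : ℝ) (f : L2) :
    L2.mulBackground R κ f =ᵐ[volume] fun x => background R κ x * f x := by
  have h := (ContinuousLinearMap.mul ℂ ℂ).coeFn_holder (r := 2)
    ((background_memLp R κ).toLp _) f
  filter_upwards [h, (background_memLp R κ).coeFn_toLp] with x h1 h2
  refine h1.trans ?_
  rw [h2]
  rfl

theorem IsWeakDeriv.mulBackground (R : ℂ) (κ : ℝ) {f g : L2} (h : IsWeakDeriv f g) :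
    IsWeakDeriv (L2.mulBackground R κ f)
      (L2.mulBackground R κ g + (-(Complex.I * κ)) • L2.mulBackground R κ f) := by
  refine IsWeakDeriv.of_schwartz
    (B := fun p => L2.mulBackground R κ p.2 + (-(Complex.I * κ)) • L2.mulBackground R κ p.1)
    (L2.mulBackground R κ).continuous (by fun_prop) (fun φ => ?_) h
  refine .of_hasDerivAt
    (fun x => (hasDerivAt_background R κ x).mul (φ.hasDerivAt x)) ?_ ?_
  · filter_upwards [L2.coeFn_mulBackground R κ (φ.toLp 2), φ.coeFn_toLp 2 volume] with x h1 h2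
    rw [h1, h2]
    rfl
  · filter_upwards [L2.coeFn_mulBackground R κ (φ.toLp 2), φ.coeFn_toLp 2 volume,
      L2.coeFn_mulBackground R κ ((SchwartzMap.derivCLM ℂ ℂ φ).toLp 2),
      (SchwartzMap.derivCLM ℂ ℂ φ).coeFn_toLp 2 volume,
      Lp.coeFn_add (L2.mulBackground R κ ((SchwartzMap.derivCLM ℂ ℂ φ).toLp 2))
        ((-(Complex.I * κ)) • L2.mulBackground R κ (φ.toLp 2)),
      Lp.coeFn_smul (-(Complex.I * κ)) (L2.mulBackground R κ (φ.toLp 2))]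
      with x h1 h2 h3 h4 h5 h6
    rw [h5, Pi.add_apply, h6, Pi.smul_apply, h1, h2, h3, h4, SchwartzMap.derivCLM_apply,
      smul_eq_mul]
    ring

namespace Hk

variable {k : ℕ}

/-- Complex conjugation on `H^k`. -/
def conj : Hk k →+ Hk k := map L2.conj IsWeakDeriv.conj

theorem coeFn_conj (u : Hk k) : toL2 (conj u) =ᵐ[volume] fun x => (starRingEnd ℂ) (toL2 u x) :=
  L2.coeFn_conj _

theorem norm_conj (u : Hk k) : ‖conj u‖ = ‖u‖ := norm_map _ _ L2.norm_conj u

theorem init_conj (u : Hk (k + 1)) : init (conj u) = conj (init u) := rfl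

/-- Multiplication by the background preserves `H^k`, since `D(η u) = η Du - iκ η u`. -/
theorem exists_mulBackground (R : ℂ) (κ : ℝ) (k : ℕ) : ∃ C : ℝ, 0 ≤ C ∧ ∀ u : Hk k, ∃ w : Hk k,
    toL2 w = L2.mulBackground R κ (toL2 u) ∧ ‖w‖ ≤ C * ‖u‖ := by
  induction k with
  | zero =>
    refine ⟨‖L2.mulBackground R κ‖, norm_nonneg _, fun u =>
      ⟨ofL2 (L2.mulBackground R κ (toL2 u)), rfl, ?_⟩⟩
    rw [norm_ofL2]
    exact (ContinuousLinearMap.le_opNorm _ _).trans (by gcongr; exact norm_toL2_le u)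
  | succ k ih =>
    obtain ⟨C, hC, h⟩ := ih
    refine ⟨‖L2.mulBackground R κ‖ + C + ‖-(Complex.I * (κ : ℂ))‖ * C, by positivity,
      fun u => ?_⟩
    obtain ⟨p, hp, np⟩ := h (tail u)
    obtain ⟨q, hq, nq⟩ := h (init u)
    have hd : IsWeakDeriv (L2.mulBackground R κ (toL2 u))
        (toL2 (p + (-(Complex.I * (κ : ℂ))) • q)) := by
      rw [toL2_add, toL2_smul, hp, hq]
      exact (isWeakDeriv_tail u).mulBackground R κ
    refine ⟨cons _ _ hd, rfl, (norm_cons_le _ _ _).trans ?_⟩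
    have h1 := norm_add_le p ((-(Complex.I * (κ : ℂ))) • q)
    rw [norm_smul] at h1
    have h2 : ‖L2.mulBackground R κ (toL2 u)‖ ≤ ‖L2.mulBackground R κ‖ * ‖u‖ :=
      (ContinuousLinearMap.le_opNorm _ _).trans (by gcongr; exact norm_toL2_le u)
    have h3 : C * ‖tail u‖ ≤ C * ‖u‖ := by gcongr; exact norm_tail_le u
    have h4 : ‖q‖ ≤ C * ‖u‖ := nq.trans (by gcongr; exact norm_init_le u)
    have h5 : ‖-(Complex.I * (κ : ℂ))‖ * ‖q‖ ≤ ‖-(Complex.I * (κ : ℂ))‖ * (C * ‖u‖) := by gcongr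
    nlinarith

/-- Multiplication by the background on `H^k`. -/
def mulBackground (R : ℂ) (κ : ℝ) (u : Hk k) : Hk k :=
  ((exists_mulBackground R κ k).choose_spec.2 u).choose

theorem toL2_mulBackground (R : ℂ) (κ : ℝ) (u : Hk k) :
    toL2 (mulBackground R κ u) = L2.mulBackground R κ (toL2 u) :=
  ((exists_mulBackground R κ k).choose_spec.2 u).choose_spec.1

theorem coeFn_mulBackground (R : ℂ) (κ : ℝ) (u : Hk k) :
    toL2 (mulBackground R κ u) =ᵐ[volume] fun x => background R κ x * toL2 u x := by
  rw [toL2_mulBackground]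
  exact L2.coeFn_mulBackground R κ _

theorem exists_norm_mulBackground_le (R : ℂ) (κ : ℝ) (k : ℕ) :
    ∃ C : ℝ, 0 ≤ C ∧ ∀ u : Hk k, ‖mulBackground R κ u‖ ≤ C * ‖u‖ :=
  ⟨_, (exists_mulBackground R κ k).choose_spec.1, fun u =>
    ((exists_mulBackground R κ k).choose_spec.2 u).choose_spec.2⟩

theorem mulBackground_sub (R : ℂ) (κ : ℝ) (u v : Hk k) :
    mulBackground R κ (u - v) = mulBackground R κ u - mulBackground R κ v := by
  refine toL2_injective ?_
  rw [toL2_sub, toL2_mulBackground, toL2_mulBackground, toL2_mulBackground, toL2_sub, map_sub]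

theorem init_mulBackground (R : ℂ) (κ : ℝ) (u : Hk (k + 1)) :
    init (mulBackground R κ u) = mulBackground R κ (init u) := by
  refine toL2_injective ?_
  rw [toL2_init, toL2_mulBackground, toL2_mulBackground, toL2_init]

end Hk

/-! ### The free Schrödinger group -/

theorem norm_schrodingerSymbol (t x : ℝ) : ‖schrodingerSymbol t x‖ = 1 := by
  rw [schrodingerSymbol, Complex.norm_exp_ofReal_mul_I]

theorem schrodingerSymbol_add (s t x : ℝ) :
    schrodingerSymbol (s + t) x = schrodingerSymbol s x * schrodingerSymbol t x := by
  rw [schrodingerSymbol, schrodingerSymbol, schrodingerSymbol, ← Complex.exp_add]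
  congr 1
  push_cast
  ring

theorem coeFn_fourier_freeEvolution (t : ℝ) (f : L2) :
    (𝓕 (freeEvolution t f) : L2) =ᵐ[volume] fun x => schrodingerSymbol t x * (𝓕 f : L2) x := by
  rw [freeEvolution, FourierTransform.fourier_fourierInv_eq]
  filter_upwards [Lp.coeFn_lpSMul (r := 2) ((schrodingerSymbol_memLp t).toLp (schrodingerSymbol t))
    (𝓕 f : L2), (schrodingerSymbol_memLp t).coeFn_toLp] with x h1 h2
  rw [h1, Pi.smul_apply', h2, smul_eq_mul]

theorem L2.fourier_injective : Function.Injective (fun f : L2 => (𝓕 f : L2)) :=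
  (Lp.fourierTransformₗᵢ ℝ ℂ).injective

theorem norm_freeEvolution (t : ℝ) (f : L2) : ‖freeEvolution t f‖ = ‖f‖ := by
  rw [← Lp.norm_fourier_eq, ← Lp.norm_fourier_eq f, Lp.norm_def, Lp.norm_def]
  congr 1
  refine eLpNorm_congr_norm_ae ?_
  filter_upwards [coeFn_fourier_freeEvolution t f] with x hx
  rw [hx, norm_mul, norm_schrodingerSymbol, one_mul]

theorem freeEvolution_add (t : ℝ) (f g : L2) :
    freeEvolution t (f + g) = freeEvolution t f + freeEvolution t g := by
  rw [freeEvolution, freeEvolution, freeEvolution, ← FourierTransform.fourierInv_add]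
  congr 1
  rw [FourierTransform.fourier_add, Lp.add_smul]

theorem freeEvolution_smul (t : ℝ) (c : ℂ) (f : L2) :
    freeEvolution t (c • f) = c • freeEvolution t f := by
  rw [freeEvolution, freeEvolution, ← FourierTransform.fourierInv_smul]
  congr 1
  rw [FourierTransform.fourier_smul, ← Lp.smul_comm]

theorem freeEvolution_freeEvolution (s t : ℝ) (f : L2) :
    freeEvolution s (freeEvolution t f) = freeEvolution (s + t) f := by
  refine L2.fourier_injective (Lp.ext ?_)
  filter_upwards [coeFn_fourier_freeEvolution s (freeEvolution t f),
    coeFn_fourier_freeEvolution t f, coeFn_fourier_freeEvolution (s + t) f] with x h1 h2 h3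
  rw [h1, h2, h3, schrodingerSymbol_add, mul_assoc]

theorem freeEvolution_zero (f : L2) : freeEvolution 0 f = f := by
  refine L2.fourier_injective (Lp.ext ?_)
  filter_upwards [coeFn_fourier_freeEvolution 0 f] with x h1
  rw [h1]
  simp [schrodingerSymbol]

/-- `U(t)` as an additive map of `L²`. -/
def evolutionHom (t : ℝ) : L2 →+ L2 := AddMonoidHom.mk' (freeEvolution t) (freeEvolution_add t)

theorem evolutionHom_apply (t : ℝ) (f : L2) : evolutionHom t f = freeEvolution t f := rfl

/-- `U(t)` as a linear isometry of `L²`. -/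
def evolution (t : ℝ) : L2 →ₗᵢ[ℂ] L2 where
  toFun := freeEvolution t
  map_add' := freeEvolution_add t
  map_smul' := freeEvolution_smul t
  norm_map' := norm_freeEvolution t

theorem norm_sq_freeEvolution_sub (s t : ℝ) (f : L2) :
    ‖freeEvolution s f - freeEvolution t f‖ ^ 2 =
      ∫ x, ‖schrodingerSymbol s x - schrodingerSymbol t x‖ ^ 2 * ‖(𝓕 f : L2) x‖ ^ 2 := by
  have e : (𝓕 (freeEvolution s f - freeEvolution t f) : L2) =
      𝓕 (freeEvolution s f) - 𝓕 (freeEvolution t f) :=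
    (Lp.fourierTransformₗᵢ ℝ ℂ).map_sub _ _
  rw [← Lp.norm_fourier_eq, e, ← L2.integral_norm_sq]
  refine integral_congr_ae ?_
  filter_upwards [coeFn_fourier_freeEvolution s f, coeFn_fourier_freeEvolution t f,
    Lp.coeFn_sub (𝓕 (freeEvolution s f) : L2) (𝓕 (freeEvolution t f))] with x h1 h2 h3
  rw [h3, Pi.sub_apply, h1, h2, ← sub_mul, norm_mul, mul_pow]

/-- Strong continuity of the free group. -/
theorem continuous_freeEvolution_apply (f : L2) : Continuous fun t => freeEvolution t f := by
  rw [continuous_iff_continuousAt]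
  intro t
  have hc : Continuous fun s => ‖freeEvolution s f - freeEvolution t f‖ ^ 2 := by
    simp_rw [norm_sq_freeEvolution_sub]
    refine continuous_of_dominated (bound := fun x => 4 * ‖(𝓕 f : L2) x‖ ^ 2) (fun s => ?_)
      (fun s => .of_forall fun x => ?_) ((L2.integrable_norm_sq _).const_mul 4)
      (.of_forall fun x => ?_)
    · refine AEStronglyMeasurable.mul ?_ (L2.integrable_norm_sq _).aestronglyMeasurable
      exact Continuous.aestronglyMeasurable (by unfold schrodingerSymbol; fun_prop)
    · rw [Real.norm_of_nonneg (by positivity)]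
      gcongr
      have := norm_sub_le (schrodingerSymbol s x) (schrodingerSymbol t x)
      rw [norm_schrodingerSymbol, norm_schrodingerSymbol] at this
      nlinarith [norm_nonneg (schrodingerSymbol s x - schrodingerSymbol t x)]
    · unfold schrodingerSymbol
      fun_prop
  have h0 : Tendsto (fun s => ‖freeEvolution s f - freeEvolution t f‖ ^ 2) (𝓝 t) (𝓝 0) := by
    simpa using hc.tendsto t
  rw [ContinuousAt, tendsto_iff_norm_sub_tendsto_zero]
  have h1 := (Real.continuous_sqrt.tendsto 0).comp h0
  simpa [Function.comp_def, Real.sqrt_sq] using h1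

theorem IsWeakDeriv.freeEvolution (t : ℝ) (f g : L2) (h : IsWeakDeriv f g) :
    IsWeakDeriv (freeEvolution t f) (freeEvolution t g) := by
  rw [isWeakDeriv_iff_fourier] at h ⊢
  filter_upwards [h, coeFn_fourier_freeEvolution t f, coeFn_fourier_freeEvolution t g]
    with x h1 h2 h3
  rw [h3, h1, h2]
  ring

namespace Hk

variable {k : ℕ}

/-- The free evolution on `H^k`. -/
def evolution (t : ℝ) : Hk k →+ Hk k :=
  map (evolutionHom t) fun f g h => by
    rw [evolutionHom_apply, evolutionHom_apply]
    exact IsWeakDeriv.freeEvolution t f g h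

theorem toL2_evolution (t : ℝ) (u : Hk k) : toL2 (evolution t u) = freeEvolution t (toL2 u) :=
  toL2_map _ _ u

theorem norm_evolution (t : ℝ) (u : Hk k) : ‖evolution t u‖ = ‖u‖ :=
  norm_map _ _ (fun f => by rw [evolutionHom_apply, norm_freeEvolution]) u

theorem evolution_evolution (s t : ℝ) (u : Hk k) :
    evolution s (evolution t u) = evolution (s + t) u :=
  toL2_injective (by simp only [toL2_evolution, freeEvolution_freeEvolution])

theorem evolution_zero (u : Hk k) : evolution 0 u = u :=
  toL2_injective (by rw [toL2_evolution, freeEvolution_zero])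

theorem init_evolution (t : ℝ) (u : Hk (k + 1)) : init (evolution t u) = evolution t (init u) := rfl

theorem continuous_evolution_apply (u : Hk k) : Continuous fun t => evolution t u := by
  have h : Continuous fun t => fun i : Fin (k + 1) =>
      freeEvolution t ((u : PiLp 2 (fun _ : Fin (k + 1) => L2)) i) :=
    continuous_pi fun i => continuous_freeEvolution_apply _
  exact continuous_induced_rng.2 ((PiLp.continuous_toLp 2 (fun _ : Fin (k + 1) => L2)).comp h)

theorem continuous_evolution : Continuous fun p : ℝ × Hk k => evolution p.1 p.2 := by
  refine continuous_prod_of_continuous_lipschitzWith' _ 1 (fun t => ?_) continuous_evolution_apply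
  refine LipschitzWith.of_dist_le_mul fun u v => ?_
  rw [dist_eq_norm, dist_eq_norm, ← map_sub, norm_evolution, NNReal.coe_one, one_mul]

end Hk

/-! ### Maximal solutions of ordinary differential equations in Banach spaces -/

theorem mem_timeInterval_coe {T t : ℝ} : t ∈ timeInterval (T : EReal) ↔ t ∈ Ico 0 T := by
  simp [timeInterval]

theorem Icc_subset_timeInterval {T : EReal} {t : ℝ} (ht : t ∈ timeInterval T) :
    Icc 0 t ⊆ timeInterval T := fun _ hs =>
  ⟨hs.1, lt_of_le_of_lt (EReal.coe_le_coe_iff.2 hs.2) ht.2⟩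

theorem timeInterval_mem_nhdsWithin {T : EReal} {t : ℝ} (ht : t ∈ timeInterval T) :
    timeInterval T ∈ 𝓝[Ici 0] t := by
  have h1 : ∀ᶠ s : ℝ in 𝓝 t, (s : EReal) < T :=
    continuous_coe_real_ereal.continuousAt.eventually_lt continuousAt_const ht.2
  filter_upwards [h1.filter_mono nhdsWithin_le_nhds, self_mem_nhdsWithin] with s hs hs0
  exact ⟨hs0, hs⟩

theorem timeInterval_mem_nhdsGE {T : EReal} {t : ℝ} (ht : t ∈ timeInterval T) :
    timeInterval T ∈ 𝓝[≥] t :=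
  nhdsWithin_mono t (Ici_subset_Ici.2 ht.1) (timeInterval_mem_nhdsWithin ht)

theorem measurableSet_timeInterval (T : EReal) : MeasurableSet (timeInterval T) :=
  measurableSet_Ici.inter (measurable_coe_real_ereal measurableSet_Iio)

variable {E : Type*} [NormedAddCommGroup E] [NormedSpace ℝ E]

/-- A time-dependent vector field that vanishes at the origin, is continuous in time, and is
Lipschitz on every ball, uniformly in time. -/
structure IsUniformlyLipschitzField (f : ℝ → E → E) : Prop where
  map_zero : ∀ t, f t 0 = 0
  continuous : ∀ x, Continuous fun t => f t x
  lipschitz : ∀ r : ℝ, ∃ K : NNReal, ∀ t, LipschitzOnWith K (f t) (Metric.closedBall 0 r)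

/-- `v` solves `v' = f(t, v)`, `v(0) = x₀` on `[0, T)`; only the right derivative is required, which
makes it possible to glue solutions. For `T ≤ 0` the interval is empty and nothing is required. -/
structure IsODESolution (f : ℝ → E → E) (x₀ : E) (T : EReal) (v : ℝ → E) : Prop where
  continuousOn : ContinuousOn v (timeInterval T)
  initial : 0 ∈ timeInterval T → v 0 = x₀
  hasDeriv : ∀ t ∈ timeInterval T, HasDerivWithinAt v (f t (v t)) (Ici t) t

variable {f : ℝ → E → E} {x₀ : E}

theorem IsODESolution.eqOn (hf : IsUniformlyLipschitzField f) {T T' : EReal} {v w : ℝ → E}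
    (hv : IsODESolution f x₀ T v) (hw : IsODESolution f x₀ T' w) {t : ℝ}
    (ht : t ∈ timeInterval T) (ht' : t ∈ timeInterval T') : v t = w t := by
  have sv := Icc_subset_timeInterval ht
  have sw := Icc_subset_timeInterval ht'
  have cv := hv.continuousOn.mono sv
  have cw := hw.continuousOn.mono sw
  obtain ⟨r, hr⟩ := isCompact_Icc.exists_bound_of_continuousOn cv
  obtain ⟨r', hr'⟩ := isCompact_Icc.exists_bound_of_continuousOn cw
  obtain ⟨K, hK⟩ := hf.lipschitz (max r r')
  have h0 : (0 : ℝ) ∈ Icc 0 t := left_mem_Icc.2 ht.1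
  refine ODE_solution_unique_of_mem_Icc_right (s := fun _ => Metric.closedBall 0 (max r r'))
    (fun s _ => hK s) cv (fun s hs => hv.hasDeriv s (sv (Ico_subset_Icc_self hs)))
    (fun s hs => ?_) cw (fun s hs => hw.hasDeriv s (sw (Ico_subset_Icc_self hs)))
    (fun s hs => ?_) ?_ (right_mem_Icc.2 ht.1)
  · exact mem_closedBall_zero_iff.2 ((hr s (Ico_subset_Icc_self hs)).trans (le_max_left _ _))
  · exact mem_closedBall_zero_iff.2 ((hr' s (Ico_subset_Icc_self hs)).trans (le_max_right _ _))
  · rw [hv.initial (sv h0), hw.initial (sw h0)]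

/-- Local existence, on an interval whose length depends only on the norm of the initial value. -/
theorem IsUniformlyLipschitzField.exists_local [CompleteSpace E]
    (hf : IsUniformlyLipschitzField f) (r : ℝ) :
    ∃ δ : ℝ, 0 < δ ∧ ∀ (t₀ : ℝ) (x : E), ‖x‖ ≤ r → ∃ w : ℝ → E, w t₀ = x ∧
      ContinuousOn w (Icc t₀ (t₀ + δ)) ∧
      ∀ t ∈ Ico t₀ (t₀ + δ), HasDerivWithinAt w (f t (w t)) (Ici t) t := by
  obtain ⟨K, hK⟩ := hf.lipschitz (|r| + 1)
  set L : NNReal := K * Real.toNNReal (|r| + 1) with hL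
  refine ⟨1 / (L + 1), by positivity, fun t₀ x hx => ?_⟩
  set δ : ℝ := 1 / (L + 1) with hδ
  have hδ0 : 0 < δ := by positivity
  have hsub : Metric.closedBall x 1 ⊆ Metric.closedBall (0 : E) (|r| + 1) := by
    refine Metric.closedBall_subset_closedBall' ?_
    rw [dist_zero_right]
    linarith [le_abs_self r]
  have hPL : IsPicardLindelof f (tmin := t₀) (tmax := t₀ + δ) ⟨t₀, by simp [hδ0.le]⟩ x 1 0 L K :=
    { lipschitzOnWith := fun t _ => (hK t).mono hsub
      continuousOn := fun y _ => (hf.continuous y).continuousOn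
      norm_le := fun t _ y hy => by
        have h0 : (0 : E) ∈ Metric.closedBall (0 : E) (|r| + 1) :=
          Metric.mem_closedBall_self (by positivity)
        have h1 := (hK t).norm_sub_le (hsub hy) h0
        rw [hf.map_zero, sub_zero, sub_zero] at h1
        have h2 : ‖y‖ ≤ |r| + 1 := mem_closedBall_zero_iff.1 (hsub hy)
        refine h1.trans ?_
        rw [hL, NNReal.coe_mul, Real.coe_toNNReal _ (by positivity)]
        gcongr
      mul_max_le := by
        have h1 : max (t₀ + δ - t₀) (t₀ - t₀) = δ := by
          rw [add_sub_cancel_left, sub_self, max_eq_left hδ0.le]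
        simp only [h1, NNReal.coe_one, NNReal.coe_zero, sub_zero]
        rw [hδ, mul_one_div, div_le_one (by positivity)]
        linarith }
  obtain ⟨w, hw0, hw⟩ := hPL.exists_eq_forall_mem_Icc_hasDerivWithinAt₀
  refine ⟨w, hw0, fun t ht => (hw t ht).continuousWithinAt, fun t ht => ?_⟩
  exact (hw t (Ico_subset_Icc_self ht)).mono_of_mem_nhdsWithin
    (mem_of_superset (Icc_mem_nhdsGE ht.2) (Icc_subset_Icc_left ht.1))

/-- Continuation of a solution beyond a time `t₀` of its interval of existence. -/
theorem IsODESolution.glue {T : EReal} {v w : ℝ → E} (hv : IsODESolution f x₀ T v) {t₀ δ : ℝ}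
    (ht₀ : t₀ ∈ timeInterval T) (hw₀ : w t₀ = v t₀) (hwc : ContinuousOn w (Icc t₀ (t₀ + δ)))
    (hw : ∀ t ∈ Ico t₀ (t₀ + δ), HasDerivWithinAt w (f t (w t)) (Ici t) t) :
    IsODESolution f x₀ ((t₀ + δ : ℝ) : EReal) (fun t => if t < t₀ then v t else w t) := by
  have h1 : EqOn (fun t => if t < t₀ then v t else w t) v (Icc 0 t₀) := fun t ht => by
    rcases ht.2.lt_or_eq with h | h
    · simp [h]
    · simp [h, hw₀]
  have h2 : EqOn (fun t => if t < t₀ then v t else w t) w (Ici t₀) := fun t ht => by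
    simp [not_lt.2 (mem_Ici.1 ht)]
  refine ⟨?_, fun _ => ?_, fun t ht => ?_⟩
  · have c1 := (hv.continuousOn.mono (Icc_subset_timeInterval ht₀)).congr h1
    have c2 := hwc.congr (h2.mono Icc_subset_Ici_self)
    refine (c1.union_of_isClosed c2 isClosed_Icc isClosed_Icc).mono fun t ht => ?_
    rw [mem_timeInterval_coe] at ht
    rcases le_total t t₀ with h | h
    · exact Or.inl ⟨ht.1, h⟩
    · exact Or.inr ⟨h, ht.2.le⟩
  · have h0 : (0 : ℝ) ∈ Icc 0 t₀ := left_mem_Icc.2 ht₀.1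
    exact (h1 h0).trans (hv.initial (Icc_subset_timeInterval ht₀ h0))
  · rw [mem_timeInterval_coe] at ht
    rcases lt_or_ge t t₀ with h | h
    · have e : (fun t => if t < t₀ then v t else w t) =ᶠ[𝓝 t] v := by
        filter_upwards [Iio_mem_nhds h] with s hs
        simp [mem_Iio.1 hs]
      have hd := hv.hasDeriv t (Icc_subset_timeInterval ht₀ ⟨ht.1, h.le⟩)
      simpa [h] using hd.congr_of_eventuallyEq (e.filter_mono nhdsWithin_le_nhds) e.self_of_nhds
    · have hd := hw t ⟨h, ht.2⟩
      have := hd.congr (fun s hs => h2 (h.trans (mem_Ici.1 hs))) (h2 h)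
      simpa [not_lt.2 h] using this

/-- Existence of a unique maximal solution, whose norm tends to infinity at the end of its interval
of existence if that is finite. -/
theorem IsUniformlyLipschitzField.exists_maximal [CompleteSpace E]
    (hf : IsUniformlyLipschitzField f) (x₀ : E) :
    ∃ (τ : EReal) (v : ℝ → E), 0 < τ ∧ IsODESolution f x₀ τ v ∧
      (∀ (T : EReal) (w : ℝ → E), IsODESolution f x₀ T w →
        T ≤ τ ∧ ∀ t ∈ timeInterval T, w t = v t) ∧
      ∀ T : ℝ, τ = (T : EReal) → Tendsto (fun t => ‖v t‖) (𝓝[<] T) atTop := by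
  classical
  set S : Set EReal := {T | ∃ w, IsODESolution f x₀ T w} with hS
  have hex : ∀ t ∈ timeInterval (sSup S), ∃ (T : EReal) (w : ℝ → E),
      IsODESolution f x₀ T w ∧ t ∈ timeInterval T := by
    rintro t ⟨h0, ht⟩
    obtain ⟨T, ⟨w, hw⟩, hT⟩ := lt_sSup_iff.1 ht
    exact ⟨T, w, hw, h0, hT⟩
  set v : ℝ → E := fun t =>
    if h : t ∈ timeInterval (sSup S) then (hex t h).choose_spec.choose t else 0 with hvdef
  have hle : ∀ {T w}, IsODESolution f x₀ T w → T ≤ sSup S := fun hw => le_sSup ⟨_, hw⟩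
  have heq : ∀ {T w}, IsODESolution f x₀ T w → ∀ t ∈ timeInterval T, w t = v t := by
    intro T w hw t ht
    have h : t ∈ timeInterval (sSup S) := ⟨ht.1, ht.2.trans_le (hle hw)⟩
    have hs := (hex t h).choose_spec.choose_spec
    simp only [hvdef, dif_pos h]
    exact hw.eqOn hf hs.1 ht hs.2
  have hsol : IsODESolution f x₀ (sSup S) v := by
    refine ⟨fun t ht => ?_, fun h0 => ?_, fun t ht => ?_⟩
    · obtain ⟨T, w, hw, hT⟩ := hex t ht
      have hc : ContinuousWithinAt w (Ici 0) t :=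
        (hw.continuousOn t hT).mono_of_mem_nhdsWithin (timeInterval_mem_nhdsWithin hT)
      refine (hc.congr_of_eventuallyEq ?_ (heq hw t hT).symm).mono fun s hs => hs.1
      filter_upwards [timeInterval_mem_nhdsWithin hT] with s hs
      exact (heq hw s hs).symm
    · obtain ⟨T, w, hw, hT⟩ := hex 0 h0
      rw [← heq hw 0 hT, hw.initial hT]
    · obtain ⟨T, w, hw, hT⟩ := hex t ht
      rw [← heq hw t hT]
      refine (hw.hasDeriv t hT).congr_of_eventuallyEq ?_ (heq hw t hT).symm
      filter_upwards [timeInterval_mem_nhdsGE hT] with s hs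
      exact (heq hw s hs).symm
  have hpos : 0 < sSup S := by
    obtain ⟨δ, hδ, h⟩ := hf.exists_local ‖x₀‖
    obtain ⟨w, hw0, hwc, hw⟩ := h 0 x₀ le_rfl
    rw [zero_add] at hwc hw
    have hws : IsODESolution f x₀ (δ : EReal) w :=
      ⟨hwc.mono fun t ht => Ico_subset_Icc_self (mem_timeInterval_coe.1 ht), fun _ => hw0,
        fun t ht => hw t (mem_timeInterval_coe.1 ht)⟩
    exact lt_of_lt_of_le (EReal.coe_pos.2 hδ) (hle hws)
  refine ⟨sSup S, v, hpos, hsol, fun T w hw => ⟨hle hw, heq hw⟩, fun T hT => ?_⟩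
  -- If the norm returned below `r` at times arbitrarily close to `T`, the uniform local existence
  -- time would carry the solution beyond `T`.
  refine tendsto_atTop.2 fun r => ?_
  by_contra hcon
  obtain ⟨δ, hδ, h⟩ := hf.exists_local r
  have hT0 : 0 < T := by
    rw [hT] at hpos
    exact EReal.coe_pos.1 hpos
  have hev : ∀ᶠ t in 𝓝[<] T, t ∈ Ioo (max 0 (T - δ)) T :=
    Ioo_mem_nhdsLT (max_lt hT0 (by linarith))
  obtain ⟨t, hvt, ht⟩ := ((not_eventually.1 hcon).and_eventually hev).exists
  have hmem : t ∈ timeInterval (sSup S) := by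
    rw [hT, mem_timeInterval_coe]
    exact ⟨(le_max_left _ _).trans ht.1.le, ht.2⟩
  obtain ⟨w, hw0, hwc, hw⟩ := h t (v t) (not_le.1 hvt).le
  have hglue := hle (hsol.glue hmem hw0 hwc hw)
  rw [hT, EReal.coe_le_coe_iff] at hglue
  linarith [(le_max_right 0 (T - δ)).trans_lt ht.1]

/-! ### The nonlinearity as a map of `H^k` -/

section LipschitzOnBalls

variable {E F : Type*} [SeminormedAddCommGroup E] [SeminormedAddCommGroup F]

/-- `G` is Lipschitz on every bounded set. -/
def LipschitzOnBalls (G : E → F) : Prop :=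
  ∀ r : ℝ, ∃ K : ℝ, 0 ≤ K ∧ ∀ u v, ‖u‖ ≤ r → ‖v‖ ≤ r → ‖G u - G v‖ ≤ K * ‖u - v‖

theorem LipschitzOnBalls.add {G G' : E → F} (h : LipschitzOnBalls G) (h' : LipschitzOnBalls G') :
    LipschitzOnBalls fun u => G u + G' u := by
  intro r
  obtain ⟨K, hK, hG⟩ := h r
  obtain ⟨K', hK', hG'⟩ := h' r
  refine ⟨K + K', by positivity, fun u v hu hv => ?_⟩
  rw [add_sub_add_comm, add_mul]
  exact (norm_add_le _ _).trans (add_le_add (hG u v hu hv) (hG' u v hu hv))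

theorem LipschitzOnBalls.comp_bound {E' : Type*} [SeminormedAddCommGroup E'] {A : F → E'} {C : ℝ}
    (hC : 0 ≤ C) (hsub : ∀ u v, A (u - v) = A u - A v) (hA : ∀ u, ‖A u‖ ≤ C * ‖u‖)
    {G : E → F} (h : LipschitzOnBalls G) : LipschitzOnBalls fun u => A (G u) := by
  intro r
  obtain ⟨K, hK, hG⟩ := h r
  refine ⟨C * K, by positivity, fun u v hu hv => ?_⟩
  rw [← hsub, mul_assoc]
  exact (hA _).trans (by gcongr; exact hG u v hu hv)

theorem LipschitzOnBalls.bounded {G : E → F} (h : LipschitzOnBalls G) (r : ℝ) :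
    ∃ B : ℝ, ∀ u, ‖u‖ ≤ r → ‖G u‖ ≤ B := by
  obtain ⟨K, hK, hG⟩ := h r
  refine ⟨K * r + ‖G 0‖, fun u hu => ?_⟩
  have hr : 0 ≤ r := (norm_nonneg u).trans hu
  have h1 := hG u 0 hu (by simpa using hr)
  rw [sub_zero] at h1
  have h2 : K * ‖u‖ ≤ K * r := by gcongr
  linarith [norm_sub_norm_le (G u) (G 0)]

theorem lipschitzOnBalls_id : LipschitzOnBalls fun u : E => u :=
  fun _ => ⟨1, zero_le_one, fun u v _ _ => by rw [one_mul]⟩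

end LipschitzOnBalls

namespace Hk

variable {k : ℕ}

theorem lipschitzOnBalls_mul {G G' : Hk (k + 1) → Hk (k + 1)} (h : LipschitzOnBalls G)
    (h' : LipschitzOnBalls G') : LipschitzOnBalls fun u => mul (G u) (G' u) := by
  intro r
  obtain ⟨C, hC, hmul⟩ := exists_norm_mul_le k
  obtain ⟨K, hK, hG⟩ := h r
  obtain ⟨K', hK', hG'⟩ := h' r
  obtain ⟨B, hB⟩ := h.bounded r
  obtain ⟨B', hB'⟩ := h'.bounded r
  refine ⟨C * (K * |B'| + |B| * K'), by positivity, fun u v hu hv => ?_⟩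
  rw [mul_sub_mul]
  refine (norm_add_le _ _).trans ((add_le_add (hmul _ _) (hmul _ _)).trans ?_)
  have h1 : ‖G u - G v‖ * ‖G' u‖ ≤ (K * ‖u - v‖) * |B'| := by
    gcongr
    · exact hG u v hu hv
    · exact (hB' u hu).trans (le_abs_self _)
  have h2 : ‖G v‖ * ‖G' u - G' v‖ ≤ |B| * (K' * ‖u - v‖) := by
    gcongr
    · exact (hB v hv).trans (le_abs_self _)
    · exact hG' u v hu hv
  nlinarith

/-- The modulus difference `|u + η|² - |η|² = u ū + η̄ u + η ū`. -/
def modulusDiff (R : ℂ) (κ : ℝ) (u : Hk (k + 1)) : Hk (k + 1) :=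
  mul u (conj u) + mulBackground ((starRingEnd ℂ) R) (-κ) u + mulBackground R κ (conj u)

theorem coeFn_modulusDiff (R : ℂ) (κ : ℝ) (u : Hk (k + 1)) :
    toL2 (modulusDiff R κ u) =ᵐ[volume] fun x =>
      ((‖toL2 u x + background R κ x‖ ^ 2 - ‖background R κ x‖ ^ 2 : ℝ) : ℂ) := by
  rw [modulusDiff]
  filter_upwards [coeFn_add (mul u (conj u) + mulBackground ((starRingEnd ℂ) R) (-κ) u)
      (mulBackground R κ (conj u)),
    coeFn_add (mul u (conj u)) (mulBackground ((starRingEnd ℂ) R) (-κ) u),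
    coeFn_mul u (conj u), coeFn_conj u, coeFn_mulBackground ((starRingEnd ℂ) R) (-κ) u,
    coeFn_mulBackground R κ (conj u)] with x h1 h2 h3 h4 h5 h6
  rw [h1, h2, h3, h5, h6, h4, ← conj_background]
  have e : ∀ z : ℂ, ((‖z‖ ^ 2 : ℝ) : ℂ) = z * (starRingEnd ℂ) z := fun z => by
    rw [Complex.mul_conj, Complex.normSq_eq_norm_sq]
  rw [Complex.ofReal_sub, e, e, map_add]
  ring

/-- The forcing term of Duhamel's formula as a map of `H^(k+1)`; the nonlinearity enters as
`-N(u) = (3λ/2ω) (q u + η q)` with `q = |u + η|² - |η|²`. -/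
def forcing (α lam ω ν κ : ℝ) (R : ℂ) (u : Hk (k + 1)) : Hk (k + 1) :=
  (Complex.I * ((α / 2 : ℝ) : ℂ) + ((3 * lam / (2 * ω) * ‖R‖ ^ 2 - ν : ℝ) : ℂ)) • u +
    ((3 * lam / (2 * ω) : ℝ) : ℂ) •
      (mul (modulusDiff R κ u) u + mulBackground R κ (modulusDiff R κ u))

variable (α lam ω ν κ : ℝ) (R : ℂ)

theorem coeFn_forcing (u : Hk (k + 1)) : toL2 (forcing α lam ω ν κ R u) =ᵐ[volume]
    LugiatoLefever.forcing α lam ω ν κ R (toL2 u) := by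
  rw [forcing]
  filter_upwards [coeFn_add
      ((Complex.I * ((α / 2 : ℝ) : ℂ) + ((3 * lam / (2 * ω) * ‖R‖ ^ 2 - ν : ℝ) : ℂ)) • u)
      (((3 * lam / (2 * ω) : ℝ) : ℂ) •
      (mul (modulusDiff R κ u) u + mulBackground R κ (modulusDiff R κ u))),
    coeFn_smul (Complex.I * ((α / 2 : ℝ) : ℂ) + ((3 * lam / (2 * ω) * ‖R‖ ^ 2 - ν : ℝ) : ℂ)) u,
    coeFn_smul ((3 * lam / (2 * ω) : ℝ) : ℂ)
      (mul (modulusDiff R κ u) u + mulBackground R κ (modulusDiff R κ u)),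
    coeFn_add (mul (modulusDiff R κ u) u) (mulBackground R κ (modulusDiff R κ u)),
    coeFn_mul (modulusDiff R κ u) u, coeFn_mulBackground R κ (modulusDiff R κ u),
    coeFn_modulusDiff R κ u] with x h1 h2 h3 h4 h5 h6 h7
  rw [h1, h2, h3, h4, h5, h6, h7, LugiatoLefever.forcing, nonlinearity]
  ring

theorem init_forcing (u : Hk (k + 2)) :
    init (forcing α lam ω ν κ R u) = forcing α lam ω ν κ R (init u) :=
  ext_ae ((coeFn_forcing α lam ω ν κ R u).trans (coeFn_forcing α lam ω ν κ R (init u)).symm)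

theorem forcing_zero : forcing α lam ω ν κ R (0 : Hk (k + 1)) = 0 := by
  refine ext_ae ((coeFn_forcing α lam ω ν κ R _).trans ?_)
  have h0 : (toL2 (0 : Hk (k + 1))) = 0 := rfl
  rw [h0]
  refine Eventually.of_forall fun x => ?_
  simp [LugiatoLefever.forcing, nonlinearity]

theorem lipschitzOnBalls_mulBackground {G : Hk (k + 1) → Hk (k + 1)} (h : LipschitzOnBalls G) :
    LipschitzOnBalls fun u => mulBackground R κ (G u) := by
  obtain ⟨C, hC, hb⟩ := exists_norm_mulBackground_le R κ (k + 1)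
  exact h.comp_bound hC (mulBackground_sub R κ) hb

theorem lipschitzOnBalls_conj {G : Hk (k + 1) → Hk (k + 1)} (h : LipschitzOnBalls G) :
    LipschitzOnBalls fun u => conj (G u) :=
  h.comp_bound zero_le_one (map_sub conj) fun u => by rw [norm_conj, one_mul]

theorem lipschitzOnBalls_smul (c : ℂ) {G : Hk (k + 1) → Hk (k + 1)} (h : LipschitzOnBalls G) :
    LipschitzOnBalls fun u => c • G u :=
  h.comp_bound (norm_nonneg c) (smul_sub c) fun u => (norm_smul c u).le

theorem lipschitzOnBalls_forcing :
    LipschitzOnBalls (forcing α lam ω ν κ R : Hk (k + 1) → Hk (k + 1)) := by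
  have hid : LipschitzOnBalls fun u : Hk (k + 1) => u := lipschitzOnBalls_id
  have hq : LipschitzOnBalls (modulusDiff R κ : Hk (k + 1) → Hk (k + 1)) :=
    ((lipschitzOnBalls_mul hid (lipschitzOnBalls_conj hid)).add
      (lipschitzOnBalls_mulBackground _ _ hid)).add
      (lipschitzOnBalls_mulBackground _ _ (lipschitzOnBalls_conj hid))
  exact (lipschitzOnBalls_smul _ hid).add (lipschitzOnBalls_smul _
    ((lipschitzOnBalls_mul hq hid).add (lipschitzOnBalls_mulBackground _ _ hq)))

/-! ### Tame estimates -/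

/-- `P a u` expresses that a low-order size of `u ∈ H^(k+1)` is at most `a`, where the low-order
size is submultiplicative and multiplication is tame with respect to it. -/
structure IsTameSize (P : ℝ → Hk (k + 1) → Prop) : Prop where
  add : ∀ {a b u v}, P a u → P b v → P (a + b) (u + v)
  mul : ∃ C : ℝ, ∀ {a b u v}, P a u → P b v → P (C * (a * b)) (mul u v)
  conj : ∀ {a u}, P a u → P a (conj u)
  mulBackground : ∀ (R : ℂ) (κ : ℝ), ∃ C : ℝ, ∀ {a u}, P a u → P (C * a) (mulBackground R κ u)
  norm_mul_le : ∃ C : ℝ, 0 ≤ C ∧ ∀ {a b u v}, P a u → P b v →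
    ‖Hk.mul u v‖ ≤ C * (a * ‖v‖ + b * ‖u‖)

/-- If a low-order size of `u` is bounded, then the forcing grows at most linearly in `u`. -/
theorem IsTameSize.exists_norm_forcing_le {P : ℝ → Hk (k + 1) → Prop} (hP : IsTameSize P) (M : ℝ) :
    ∃ K : ℝ, 0 ≤ K ∧ ∀ u : Hk (k + 1), P M u → ‖forcing α lam ω ν κ R u‖ ≤ K * ‖u‖ := by
  obtain ⟨C, hC, hmul⟩ := hP.norm_mul_le
  obtain ⟨C', hmul'⟩ := hP.mul
  obtain ⟨B₁, hB₁⟩ := hP.mulBackground ((starRingEnd ℂ) R) (-κ)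
  obtain ⟨B₂, hB₂⟩ := hP.mulBackground R κ
  obtain ⟨D₁, hD₁0, hD₁⟩ := exists_norm_mulBackground_le ((starRingEnd ℂ) R) (-κ) (k + 1)
  obtain ⟨D₂, hD₂0, hD₂⟩ := exists_norm_mulBackground_le R κ (k + 1)
  set A : ℝ := C' * (M * M) + B₁ * M + B₂ * M with hA
  set Q : ℝ := C * (|M| + |M|) + D₁ + D₂ with hQ
  have hQ0 : 0 ≤ Q := by positivity
  set c₁ := Complex.I * ((α / 2 : ℝ) : ℂ) + ((3 * lam / (2 * ω) * ‖R‖ ^ 2 - ν : ℝ) : ℂ)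
  set c₂ := ((3 * lam / (2 * ω) : ℝ) : ℂ)
  refine ⟨‖c₁‖ + ‖c₂‖ * (C * (|A| + |M| * Q) + D₂ * Q), by positivity, fun u hu => ?_⟩
  have hqP : P A (modulusDiff R κ u) :=
    hP.add (hP.add (hmul' hu (hP.conj hu)) (hB₁ hu)) (hB₂ (hP.conj hu))
  have hq : ‖modulusDiff R κ u‖ ≤ Q * ‖u‖ := by
    have h1 := hmul hu (hP.conj hu)
    rw [norm_conj] at h1
    have h2 := hD₂ (Hk.conj u)
    rw [norm_conj] at h2
    have h3 := norm_add₃_le (a := Hk.mul u (Hk.conj u))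
      (b := Hk.mulBackground ((starRingEnd ℂ) R) (-κ) u) (c := Hk.mulBackground R κ (Hk.conj u))
    have h4 : C * (M * ‖u‖ + M * ‖u‖) ≤ C * (|M| * ‖u‖ + |M| * ‖u‖) := by
      gcongr <;> exact le_abs_self M
    have h5 := hD₁ u
    rw [modulusDiff, hQ]
    linarith
  have h1 := hmul hqP hu
  have h2 := hD₂ (modulusDiff R κ u)
  have h3 : A * ‖u‖ + M * ‖modulusDiff R κ u‖ ≤ |A| * ‖u‖ + |M| * (Q * ‖u‖) := by
    gcongr
    · exact le_abs_self A
    · exact le_abs_self M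
  have h4 : ‖Hk.mul (modulusDiff R κ u) u + Hk.mulBackground R κ (modulusDiff R κ u)‖
      ≤ (C * (|A| + |M| * Q) + D₂ * Q) * ‖u‖ := by
    refine (norm_add_le _ _).trans ?_
    have h5 : C * (A * ‖u‖ + M * ‖modulusDiff R κ u‖) ≤ C * (|A| * ‖u‖ + |M| * (Q * ‖u‖)) := by
      gcongr
    have h6 : D₂ * ‖modulusDiff R κ u‖ ≤ D₂ * (Q * ‖u‖) := by gcongr
    linarith
  rw [forcing]
  refine (norm_add_le _ _).trans ?_
  rw [norm_smul, norm_smul, add_mul, mul_assoc]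
  gcongr

/-- On `H¹` the sup norm is a tame size. -/
theorem isTameSize_sup :
    IsTameSize fun (a : ℝ) (u : Hk 1) => ∀ᵐ x, ‖toL2 u x‖ ≤ a where
  add := by
    intro a b u v hu hv
    filter_upwards [hu, hv, coeFn_add u v] with x h1 h2 h3
    rw [h3]
    exact (norm_add_le _ _).trans (add_le_add h1 h2)
  mul := by
    refine ⟨1, fun {a b u v} hu hv => ?_⟩
    filter_upwards [hu, hv, coeFn_mul u v] with x h1 h2 h3
    rw [h3, norm_mul, one_mul]
    have := (norm_nonneg _).trans h1
    gcongr
  conj := by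
    intro a u hu
    filter_upwards [hu, coeFn_conj u] with x h1 h2
    rwa [h2, RCLike.norm_conj]
  mulBackground := by
    refine fun R κ => ⟨‖R‖, fun {a u} hu => ?_⟩
    filter_upwards [hu, coeFn_mulBackground R κ u] with x h1 h2
    rw [h2, norm_mul, norm_background]
    gcongr
  norm_mul_le := ⟨2, by norm_num, fun hu hv => norm_mul_one_le hu hv⟩

/-- On `H^(k+2)` the norm of `H^(k+1)` is a tame size. -/
theorem isTameSize_init (k : ℕ) :
    IsTameSize fun (a : ℝ) (u : Hk (k + 2)) => ‖init u‖ ≤ a where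
  add := fun {a b u v} hu hv => (norm_add_le (init u) (init v)).trans (add_le_add hu hv)
  mul := by
    obtain ⟨C, hC, h⟩ := exists_norm_mul_le k
    refine ⟨C, fun {a b u v} hu hv => ?_⟩
    rw [init_mul]
    have := (norm_nonneg _).trans hu
    exact (h _ _).trans (by gcongr)
  conj := by
    intro a u hu
    rwa [init_conj, norm_conj]
  mulBackground := by
    intro R κ
    obtain ⟨C, hC, h⟩ := exists_norm_mulBackground_le R κ (k + 1)
    refine ⟨C, fun {a u} hu => ?_⟩
    rw [init_mulBackground]
    exact (h _).trans (by gcongr)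
  norm_mul_le := by
    obtain ⟨C, hC, h⟩ := exists_norm_mul_tame_le k
    refine ⟨C, hC, fun {a b u v} hu hv => (h u v).trans ?_⟩
    gcongr

end Hk

/-! ### Integral form of differential equations, and linear growth -/

theorem continuous_uncurry_comp {A B C X : Type*} [TopologicalSpace A] [TopologicalSpace B]
    [TopologicalSpace C] [TopologicalSpace X] {f : A → B → C}
    (hf : Continuous fun p : A × B => f p.1 p.2) {a : X → A} {b : X → B} (ha : Continuous a)
    (hb : Continuous b) : Continuous fun x => f (a x) (b x) :=
  hf.comp (ha.prodMk hb)

theorem continuousOn_uncurry_comp {A B C X : Type*} [TopologicalSpace A]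
    [TopologicalSpace B] [TopologicalSpace C] [TopologicalSpace X] {f : A → B → C}
    (hf : Continuous fun p : A × B => f p.1 p.2) {s : Set X} {a : X → A} {b : X → B}
    (ha : ContinuousOn a s) (hb : ContinuousOn b s) : ContinuousOn (fun x => f (a x) (b x)) s :=
  hf.comp_continuousOn (ha.prodMk hb)

theorem intervalIntegrable_of_continuousOn_timeInterval {E : Type*} [NormedAddCommGroup E]
    {T : EReal} {w : ℝ → E}
    (hw : ContinuousOn w (timeInterval T)) {t : ℝ} (ht : t ∈ timeInterval T) :
    IntervalIntegrable w volume 0 t := by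
  refine ContinuousOn.intervalIntegrable ?_
  rw [uIcc_of_le ht.1]
  exact hw.mono (Icc_subset_timeInterval ht)

section DuhamelODE

variable {E : Type*} [NormedAddCommGroup E] [NormedSpace ℝ E] {f : ℝ → E → E} {x₀ : E}

theorem IsODESolution.eq_add_integral [CompleteSpace E] {T : EReal} {v : ℝ → E}
    (hv : IsODESolution f x₀ T v) (hw : ContinuousOn (fun s => f s (v s)) (timeInterval T)) {t : ℝ}
    (ht : t ∈ timeInterval T) : v t = x₀ + ∫ s in (0 : ℝ)..t, f s (v s) := by
  have hsub := Icc_subset_timeInterval ht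
  rw [intervalIntegral.integral_eq_sub_of_hasDeriv_right (f := v), hv.initial (hsub ⟨le_rfl, ht.1⟩),
    add_sub_cancel]
  · rw [uIcc_of_le ht.1]
    exact hv.continuousOn.mono hsub
  · intro s hs
    rw [min_eq_left ht.1, max_eq_right ht.1] at hs
    exact (hv.hasDeriv s (hsub (Ioo_subset_Icc_self hs))).mono Ioi_subset_Ici_self
  · exact intervalIntegrable_of_continuousOn_timeInterval hw ht

theorem IsODESolution.of_eq_add_integral [CompleteSpace E] {T : EReal} {v : ℝ → E}
    (hw : ContinuousOn (fun s => f s (v s)) (timeInterval T))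
    (hv : ∀ t ∈ timeInterval T, v t = x₀ + ∫ s in (0 : ℝ)..t, f s (v s)) :
    IsODESolution f x₀ T v := by
  have hd : ∀ t ∈ timeInterval T, HasDerivWithinAt v (f t (v t)) (Ici t) t := by
    intro t ht
    have h1 : StronglyMeasurableAtFilter (fun s => f s (v s)) (𝓝[>] t) volume :=
      (hw.stronglyMeasurableAtFilter_nhdsWithin (measurableSet_timeInterval T) t).filter_mono
        (nhdsWithin_le_of_mem (nhdsWithin_mono t Ioi_subset_Ici_self (timeInterval_mem_nhdsGE ht)))
    have h2 : ContinuousWithinAt (fun s => f s (v s)) (Ioi t) t :=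
      (hw t ht).mono_of_mem_nhdsWithin
        (nhdsWithin_mono t Ioi_subset_Ici_self (timeInterval_mem_nhdsGE ht))
    have h3 := (intervalIntegral.integral_hasDerivWithinAt_right (s := Ici t)
      (intervalIntegrable_of_continuousOn_timeInterval hw ht) h1 h2).const_add x₀
    refine h3.congr_of_eventuallyEq ?_ (hv t ht)
    filter_upwards [timeInterval_mem_nhdsGE ht] with s hs
    exact hv s hs
  refine ⟨fun t ht => ?_, fun h0 => ?_, hd⟩
  · -- The primitive of a function continuous on `[0, T)` is continuous there.
    obtain ⟨b, hb, htb⟩ : ∃ b ∈ timeInterval T, t < b := by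
      obtain ⟨b, h1, h2⟩ := EReal.lt_iff_exists_real_btwn.1 ht.2
      exact ⟨b, ⟨ht.1.trans (EReal.coe_lt_coe_iff.1 h1).le, h2⟩, EReal.coe_lt_coe_iff.1 h1⟩
    have hsub := Icc_subset_timeInterval hb
    have hi : IntegrableOn (fun s => f s (v s)) (uIcc 0 b) volume := by
      rw [uIcc_of_le hb.1]
      exact (hw.mono hsub).integrableOn_Icc
    have hc := (intervalIntegral.continuousOn_primitive_interval hi)
    rw [uIcc_of_le hb.1] at hc
    have hc' : ContinuousOn v (Icc 0 b) :=
      (continuousOn_const.add hc).congr fun s hs => hv s (hsub hs)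
    refine (hc' t ⟨ht.1, htb.le⟩).mono_of_mem_nhdsWithin ?_
    filter_upwards [self_mem_nhdsWithin, nhdsWithin_le_nhds (Iio_mem_nhds htb)] with s hs hs'
    exact ⟨hs.1, (mem_Iio.1 hs').le⟩
  · simpa using hv 0 h0

/-- Grönwall: where the vector field grows at most linearly along a solution, the solution stays
bounded on bounded time intervals. -/
theorem IsODESolution.bounded_of_linear_growth {T a K : ℝ} {v : ℝ → E}
    (hv : IsODESolution f x₀ (T : EReal) v) (ha : 0 ≤ a) (hK : 0 ≤ K)
    (h : ∀ t ∈ Ico a T, ‖f t (v t)‖ ≤ K * ‖v t‖) : ∃ B : ℝ, ∀ t ∈ Ico a T, ‖v t‖ ≤ B := by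
  refine ⟨‖v a‖ * Real.exp (K * (T - a)), fun t ht => ?_⟩
  have hsub : Icc a t ⊆ timeInterval (T : EReal) := fun s hs =>
    mem_timeInterval_coe.2 ⟨ha.trans hs.1, hs.2.trans_lt ht.2⟩
  have h1 := norm_le_gronwallBound_of_norm_deriv_right_le (ε := 0) (hv.continuousOn.mono hsub)
    (fun s hs => hv.hasDeriv s (hsub (Ico_subset_Icc_self hs))) le_rfl
    (fun s hs => by
      rw [add_zero]
      exact h s ⟨hs.1, hs.2.trans ht.2⟩) t ⟨ht.1, le_rfl⟩
  rw [gronwallBound_ε0] at h1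
  refine h1.trans ?_
  gcongr
  exact ht.2.le

end DuhamelODE

/-! ### The interaction picture -/

namespace Hk

variable {k : ℕ} (α lam ω ν κ : ℝ) (R : ℂ)

/-- The vector field of the equation for `v(t) = U(-t) φ(t)`. -/
def field (t : ℝ) (v : Hk (k + 1)) : Hk (k + 1) :=
  Complex.I • evolution (-t) (forcing α lam ω ν κ R (evolution t v))

theorem norm_field (t : ℝ) (v : Hk (k + 1)) :
    ‖field α lam ω ν κ R t v‖ = ‖forcing α lam ω ν κ R (evolution t v)‖ := by
  rw [field, norm_smul, Complex.norm_I, one_mul, norm_evolution]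

theorem continuous_forcing :
    Continuous (forcing α lam ω ν κ R : Hk (k + 1) → Hk (k + 1)) := by
  rw [continuous_iff_continuousAt]
  intro u
  obtain ⟨K, hK, h⟩ := lipschitzOnBalls_forcing α lam ω ν κ R (k := k) (‖u‖ + 1)
  have hu : ‖u‖ ≤ ‖u‖ + 1 := by linarith
  rw [ContinuousAt, tendsto_iff_norm_sub_tendsto_zero]
  refine squeeze_zero' (g := fun w => K * ‖w - u‖) (.of_forall fun _ => norm_nonneg _) ?_ ?_
  · filter_upwards [Metric.ball_mem_nhds u one_pos] with w hw
    refine h w u ?_ hu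
    rw [mem_ball_iff_norm] at hw
    linarith [norm_sub_norm_le w u]
  · have : Continuous fun w : Hk (k + 1) => K * ‖w - u‖ := by fun_prop
    simpa using this.tendsto u

theorem continuous_field :
    Continuous fun p : ℝ × Hk (k + 1) => field α lam ω ν κ R p.1 p.2 := by
  have h1 : Continuous fun p : ℝ × Hk (k + 1) => forcing α lam ω ν κ R (evolution p.1 p.2) :=
    (continuous_forcing α lam ω ν κ R).comp continuous_evolution
  have h2 : Continuous fun p : ℝ × Hk (k + 1) =>
      evolution (-p.1) (forcing α lam ω ν κ R (evolution p.1 p.2)) :=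
    continuous_uncurry_comp (f := fun t (u : Hk (k + 1)) => evolution t u) continuous_evolution
      continuous_fst.neg h1
  exact h2.const_smul Complex.I

theorem isUniformlyLipschitzField :
    IsUniformlyLipschitzField (field α lam ω ν κ R : ℝ → Hk (k + 1) → Hk (k + 1)) where
  map_zero t := by rw [field, map_zero, forcing_zero, map_zero, smul_zero]
  continuous x := continuous_uncurry_comp (f := field α lam ω ν κ R)
    (continuous_field α lam ω ν κ R) continuous_id continuous_const
  lipschitz r := by
    obtain ⟨K, hK, h⟩ := lipschitzOnBalls_forcing α lam ω ν κ R (k := k) r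
    refine ⟨⟨K, hK⟩, fun t => LipschitzOnWith.of_dist_le_mul fun u hu v hv => ?_⟩
    rw [mem_closedBall_zero_iff] at hu hv
    rw [dist_eq_norm, dist_eq_norm, field, field, ← smul_sub, norm_smul, Complex.norm_I, one_mul,
      ← map_sub, norm_evolution]
    refine (h _ _ ?_ ?_).trans (le_of_eq ?_)
    · rwa [norm_evolution]
    · rwa [norm_evolution]
    · rw [← map_sub, norm_evolution]
      rfl

variable {α lam ω ν κ R}

theorem continuousOn_evolution {s : Set ℝ} {a : ℝ → ℝ} {w : ℝ → Hk k} (ha : Continuous a)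
    (hw : ContinuousOn w s) : ContinuousOn (fun t => evolution (a t) (w t)) s :=
  continuousOn_uncurry_comp (f := fun t (u : Hk k) => evolution t u)
    continuous_evolution ha.continuousOn hw

theorem continuousOn_field {s : Set ℝ} {w : ℝ → Hk (k + 1)} (hw : ContinuousOn w s) :
    ContinuousOn (fun t => field α lam ω ν κ R t (w t)) s :=
  continuousOn_uncurry_comp (f := field α lam ω ν κ R) (continuous_field α lam ω ν κ R)
    continuousOn_id hw

theorem evolution_neg_evolution (t : ℝ) (u : Hk k) : evolution (-t) (evolution t u) = u := by
  rw [evolution_evolution, neg_add_cancel, evolution_zero]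

theorem evolution_evolution_neg (t : ℝ) (u : Hk k) : evolution t (evolution (-t) u) = u := by
  rw [evolution_evolution, add_neg_cancel, evolution_zero]

/-- The free evolution transforms Duhamel's formula at time `t` into the integrated equation of the
interaction picture. -/
theorem duhamel_iff {φ₀ : Hk (k + 1)} {φ : ℝ → Hk (k + 1)} {t : ℝ}
    (hφ : ContinuousOn φ (uIcc 0 t)) :
    IntervalIntegrable (fun s => freeEvolution (t - s) (toL2 (forcing α lam ω ν κ R (φ s))))
      volume 0 t ∧
    (toL2 (φ t) = freeEvolution t (toL2 φ₀) + Complex.I •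
      ∫ s in (0 : ℝ)..t, freeEvolution (t - s) (toL2 (forcing α lam ω ν κ R (φ s))) ↔
    evolution (-t) (φ t) = φ₀ +
      ∫ s in (0 : ℝ)..t, field α lam ω ν κ R s (evolution (-s) (φ s))) := by
  have hF : ContinuousOn (fun s => evolution (t - s) (forcing α lam ω ν κ R (φ s))) (uIcc 0 t) :=
    continuousOn_evolution (by fun_prop) ((continuous_forcing α lam ω ν κ R).comp_continuousOn hφ)
  have hF2 : ContinuousOn
      (fun s => freeEvolution (t - s) (toL2 (forcing α lam ω ν κ R (φ s)))) (uIcc 0 t) :=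
    (toL2L (k + 1)).continuous.comp_continuousOn hF
  have hG : ContinuousOn (fun s => field α lam ω ν κ R s (evolution (-s) (φ s))) (uIcc 0 t) :=
    continuousOn_field (continuousOn_evolution continuous_neg hφ)
  refine ⟨hF2.intervalIntegrable, ?_⟩
  have key : freeEvolution t (toL2 (φ₀ +
      ∫ s in (0 : ℝ)..t, field α lam ω ν κ R s (evolution (-s) (φ s)))) =
      freeEvolution t (toL2 φ₀) + Complex.I •
      ∫ s in (0 : ℝ)..t, freeEvolution (t - s) (toL2 (forcing α lam ω ν κ R (φ s))) := by
    have h1 := (toL2L (k + 1)).intervalIntegral_comp_comm (μ := volume)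
      hG.intervalIntegrable
    have h2 : IntervalIntegrable (fun s => toL2L (k + 1)
        (field α lam ω ν κ R s (evolution (-s) (φ s)))) volume 0 t :=
      ((toL2L (k + 1)).continuous.comp_continuousOn hG).intervalIntegrable
    have h3 := (LugiatoLefever.evolution t).toContinuousLinearMap.intervalIntegral_comp_comm h2
    rw [toL2_add, freeEvolution_add, ← toL2L_apply (∫ s in (0 : ℝ)..t, _), ← h1]
    congr 1
    refine h3.symm.trans ?_
    rw [← intervalIntegral.integral_smul]
    congr 1
    ext1 s
    change freeEvolution t (toL2 (field α lam ω ν κ R s (evolution (-s) (φ s)))) = _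
    rw [field, toL2_smul, freeEvolution_smul, toL2_evolution, freeEvolution_freeEvolution,
      evolution_evolution_neg, sub_eq_add_neg]
  rw [← key]
  constructor
  · intro h
    refine toL2_injective ?_
    rw [toL2_evolution, h, freeEvolution_freeEvolution, neg_add_cancel, freeEvolution_zero]
  · intro h
    rw [← h, toL2_evolution, freeEvolution_freeEvolution, add_neg_cancel, freeEvolution_zero]

end Hk

namespace Hk

variable {k : ℕ} {α lam ω ν κ : ℝ} {R : ℂ}

/-! ### Mild solutions and persistence of regularity -/

/-- In the interaction picture a mild solution solves the ordinary differential equation. -/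
theorem isODESolution_of_isMildSolution {φ₀ : Hk (k + 1)} {T : EReal} {φ : ℝ → Hk (k + 1)}
    (h : IsMildSolution α lam ω ν κ R φ₀ T φ) :
    IsODESolution (field α lam ω ν κ R) φ₀ T fun t => evolution (-t) (φ t) := by
  obtain ⟨G, hG, hd⟩ := h.duhamel
  have hG' : ∀ s ∈ timeInterval T, G s = toL2 (forcing α lam ω ν κ R (φ s)) := fun s hs =>
    Lp.ext ((hG s hs).trans (coeFn_forcing α lam ω ν κ R (φ s)).symm)
  refine .of_eq_add_integral
    (continuousOn_field (continuousOn_evolution continuous_neg h.continuousOn)) fun t ht => ?_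
  have hsub : uIcc 0 t ⊆ timeInterval T := by
    rw [uIcc_of_le ht.1]
    exact Icc_subset_timeInterval ht
  refine (duhamel_iff (h.continuousOn.mono hsub)).2.1 ?_
  rw [(hd t ht).2]
  congr 2
  refine intervalIntegral.integral_congr fun s hs => ?_
  simp only [hG' s (hsub hs)]

/-- A solution of the ordinary differential equation of the interaction picture yields a mild
solution. -/
theorem isMildSolution_of_isODESolution {φ₀ : Hk (k + 1)} {T : EReal} {v : ℝ → Hk (k + 1)}
    (h : IsODESolution (field α lam ω ν κ R) φ₀ T v) :
    IsMildSolution α lam ω ν κ R φ₀ T fun t => evolution t (v t) := by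
  have hc : ContinuousOn (fun t => evolution t (v t)) (timeInterval T) :=
    continuousOn_evolution continuous_id h.continuousOn
  refine ⟨hc, fun h0 => by rw [h.initial h0, evolution_zero],
    fun s => toL2 (forcing α lam ω ν κ R (evolution s (v s))),
    fun s _ => coeFn_forcing α lam ω ν κ R _, fun t ht => ?_⟩
  have hsub : uIcc 0 t ⊆ timeInterval T := by
    rw [uIcc_of_le ht.1]
    exact Icc_subset_timeInterval ht
  have hd := duhamel_iff (α := α) (lam := lam) (ω := ω) (ν := ν) (κ := κ) (R := R) (φ₀ := φ₀)
    (hc.mono hsub)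
  refine ⟨hd.1, hd.2.2 ?_⟩
  simp only [evolution_neg_evolution]
  exact h.eq_add_integral (continuousOn_field h.continuousOn) ht

/-- The inclusion `H^(k+1) ⊂ H^k` as a bounded real-linear map. -/
def initL (k : ℕ) : Hk (k + 1) →L[ℝ] Hk k :=
  LinearMap.mkContinuous { toFun := init, map_add' := fun _ _ => rfl, map_smul' := fun _ _ => rfl } 1
    fun u => by rw [one_mul]; exact norm_init_le u

theorem initL_apply (u : Hk (k + 1)) : initL k u = init u := rfl

theorem init_field (t : ℝ) (u : Hk (k + 2)) :
    init (field α lam ω ν κ R t u) = field α lam ω ν κ R t (init u) := by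
  have h : ∀ w : Hk (k + 2), init (Complex.I • w) = Complex.I • init w := fun _ => rfl
  rw [field, field, h, init_evolution, init_forcing, init_evolution]

/-- A solution in `H^(k+2)` is a solution in `H^(k+1)`. -/
theorem isODESolution_init {v₀ : Hk (k + 2)} {T : EReal} {v : ℝ → Hk (k + 2)}
    (h : IsODESolution (field α lam ω ν κ R) v₀ T v) :
    IsODESolution (field α lam ω ν κ R) (init v₀) T fun t => init (v t) := by
  refine ⟨(initL (k + 1)).continuous.comp_continuousOn h.continuousOn,
    fun h0 => by rw [h.initial h0], fun t ht => ?_⟩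
  have := (initL (k + 1)).hasFDerivAt.comp_hasDerivWithinAt t (h.hasDeriv t ht)
  rw [initL_apply, init_field] at this
  exact this

/-- Persistence of regularity: as long as the sup norm stays bounded, so does every Sobolev norm.
The bound climbs from `L^∞` to `H¹` and then one derivative at a time, the estimate at each level
being linear in the norm of that level. -/
theorem bounded_of_sup_bounded {T a M : ℝ} (ha : 0 ≤ a) (k : ℕ) {v₀ : Hk (k + 1)}
    {v : ℝ → Hk (k + 1)} (h : IsODESolution (field α lam ω ν κ R) v₀ (T : EReal) v)
    (hM : ∀ t ∈ Ico a T, ∀ᵐ x, ‖toL2 (evolution t (v t)) x‖ ≤ M) :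
    ∃ B : ℝ, ∀ t ∈ Ico a T, ‖v t‖ ≤ B := by
  induction k with
  | zero =>
    obtain ⟨K, hK, hb⟩ := isTameSize_sup.exists_norm_forcing_le α lam ω ν κ R M
    refine h.bounded_of_linear_growth ha hK fun t ht => ?_
    rw [norm_field, ← norm_evolution t (v t)]
    exact hb _ (hM t ht)
  | succ k ih =>
    obtain ⟨B, hB⟩ := ih (isODESolution_init h) hM
    obtain ⟨K, hK, hb⟩ := (isTameSize_init k).exists_norm_forcing_le α lam ω ν κ R B
    refine h.bounded_of_linear_growth ha hK fun t ht => ?_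
    rw [norm_field, ← norm_evolution t (v t)]
    refine hb _ ?_
    rw [init_evolution, norm_evolution]
    exact hB t ht

/-- If the Sobolev norm of a solution blows up, then so does its sup norm. -/
theorem limsup_eLpNorm_eq_top {T : ℝ} (hT : 0 < T) {v₀ : Hk (k + 1)} {v : ℝ → Hk (k + 1)}
    (h : IsODESolution (field α lam ω ν κ R) v₀ (T : EReal) v)
    (hv : Tendsto (fun t => ‖v t‖) (𝓝[<] T) atTop) :
    limsup (fun t => eLpNorm (toL2 (evolution t (v t))) ∞ volume) (𝓝[<] T) = ⊤ := by
  by_contra hne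
  obtain ⟨M, hM1, hM2⟩ := exists_between (lt_top_iff_ne_top.2 hne)
  have hev := eventually_lt_of_limsup_lt hM1
  obtain ⟨l, hl, hsub⟩ := (mem_nhdsLT_iff_exists_Ioo_subset' hT).1
    (inter_mem hev (Ioo_mem_nhdsLT hT))
  obtain ⟨a, hla, haT⟩ := exists_between (mem_Iio.1 hl)
  have hsub' : Ico a T ⊆ Ioo l T := fun t ht => ⟨hla.trans_le ht.1, ht.2⟩
  have ha0 : 0 ≤ a := (hsub ⟨hla, haT⟩).2.1.le
  obtain ⟨B, hB⟩ := bounded_of_sup_bounded (M := M.toReal) ha0 k h fun t ht => by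
    have h1 : eLpNorm (toL2 (evolution t (v t))) ∞ volume < M := (hsub (hsub' ht)).1
    have h2 := ae_le_eLpNormEssSup (μ := volume) (f := toL2 (evolution t (v t)))
    filter_upwards [h2] with x hx
    rw [eLpNorm_exponent_top] at h1
    have h3 := ENNReal.toReal_mono hM2.ne (hx.trans h1.le)
    simpa using h3
  obtain ⟨t, ht1, ht2⟩ := ((hv.eventually_gt_atTop B).and (Ico_mem_nhdsLT haT)).exists
  exact absurd (hB t ht2) (not_le.2 ht1)

end Hk

end LugiatoLefever

end
theorem theorem1 (α lam ω ν κ h : ℝ) (R : ℂ) (hα : 0 < α) (hlam : lam < 0) (hω : 0 < ω)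
    (hR : R = -((h / (2 * ω) : ℝ) : ℂ) *
      (1 / (((3 * lam / (2 * ω) * ‖R‖ ^ 2 - (κ ^ 2 + ν) : ℝ) : ℂ)
        + Complex.I * ((α / 2 : ℝ) : ℂ))))
    (k : ℕ) (hk : 1 ≤ k) (φ₀ : LugiatoLefever.Hk k) :
    ∃ (τm : EReal) (φ : ℝ → LugiatoLefever.Hk k),
      0 < τm ∧
      LugiatoLefever.IsMildSolution α lam ω ν κ R φ₀ τm φ ∧
      (∀ (T : EReal) (ψ : ℝ → LugiatoLefever.Hk k),
        LugiatoLefever.IsMildSolution α lam ω ν κ R φ₀ T ψ →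
          T ≤ τm ∧ ∀ t ∈ LugiatoLefever.timeInterval T, ψ t = φ t) ∧
      (τm = ⊤ ∨
        ∃ T : ℝ, τm = (T : EReal) ∧
          Tendsto (fun t => ‖φ t‖) (𝓝[<] T) atTop ∧
          limsup (fun t => eLpNorm (LugiatoLefever.toL2 (φ t)) ∞ volume) (𝓝[<] T) = ⊤) := by
  obtain ⟨m, rfl⟩ : ∃ m, k = m + 1 := ⟨k - 1, by omega⟩
  obtain ⟨τ, v, hτ, hv, hmax, hblow⟩ :=
    (LugiatoLefever.Hk.isUniformlyLipschitzField α lam ω ν κ R).exists_maximal φ₀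
  refine ⟨τ, fun t => LugiatoLefever.Hk.evolution t (v t), hτ,
    LugiatoLefever.Hk.isMildSolution_of_isODESolution hv, fun T ψ hψ => ?_, ?_⟩
  · obtain ⟨hT, heq⟩ := hmax T _ (LugiatoLefever.Hk.isODESolution_of_isMildSolution hψ)
    refine ⟨hT, fun t ht => ?_⟩
    change ψ t = LugiatoLefever.Hk.evolution t (v t)
    rw [← heq t ht, LugiatoLefever.Hk.evolution_evolution_neg]
  · induction τ using EReal.rec with
    | bot => exact absurd hτ (not_lt.2 bot_le)
    | top => exact Or.inl rfl
    | coe T =>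
      have hb := hblow T rfl
      refine Or.inr ⟨T, rfl, ?_,
        LugiatoLefever.Hk.limsup_eLpNorm_eq_top (EReal.coe_pos.1 hτ) hv hb⟩
      simpa only [LugiatoLefever.Hk.norm_evolution] using hb
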